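/- Let $\mathcal S,\mathcal A$ be finite non-empty sets of sizes $S$ and $A$, and let $M=(\mathcal S,\mathcal A,H,P,r)$ be an episodic Markov decision process with horizon $H$, transition laws $P_h(\cdot\mid s,a)$ and deterministic rewards $r_h(s,a)\in[0,1]$ for $1\le h\le H$. Let a group $G$ act on $\mathcal S$ and on $\mathcal A$ so that $P_h(s'\mid gs,ga)=P_h(g^{-1}s'\mid s,a)$ and $r_h(gs,ga)=r_h(s,a)$ for all $g,h,s,a,s'$, and let $\widetilde{SA}=|(\mathcal S\times\mathcal A)/G|$ be the number of orbits of the diagonal action $g(s,a)=(gs,ga)$. For a policy $\pi=(\pi_h)_{h=1}^H$, $\pi_h:\mathcal S\to\mathcal A$, let $V_1^\pi(s)$ be the expected total reward of an episode started at $s$ in which $\pi$ is followed, and let $V_1^\star(s)=\max_\pi V_1^\pi(s)$. Given a number $K$ of episodes and bonuses $b_t$, Q-learning with UCB bonuses and symmetric experience augmentation runs as follows. Initially $Q_h(s,a)=H$, $N_h(s,a)=0$, $V_h(s)=H$ for $1\le h\le H$, and $V_{H+1}=0$ throughout. In episode $k=1,\dots,K$ the environment provides an initial state $s_1=s_1^k$,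 possibly at random and depending on the previous episodes. For $h=1,\dots,H$ the learner takes an action $a_h\in\arg\max_{a'}Q_h(s_h,a')$ (ties broken arbitrarily) and observes $s_{h+1}\sim P_h(\cdot\mid s_h,a_h)$; then, with $t=N_h(s_h,a_h)+1$ and $\alpha_t=\frac{H+1}{H+t}$, simultaneously for all $(s,a)$ in the orbit $G(s_h,a_h)$, $$N_h(s,a)\leftarrow t,\qquad Q_h(s,a)\leftarrow(1-\alpha_t)\,Q_h(s_h,a_h)+\alpha_t\,[\,r_h(s_h,a_h)+V_{h+1}(s_{h+1})+b_t\,],$$ and afterwards, for the states $s$ of these pairs, $V_h(s)\leftarrow\min\{H,\max_{a'}Q_h(s_h,a')\}$ with the updated $Q_h$. Let $\pi^k$ be the policy of the learner in episode $k$, and let the total regret be $\sum_{k=1}^K\bigl(V_1^\star(s_1^k)-V_1^{\pi^k}(s_1^k)\bigr)$. **Theorem.** There are absolute constants $c,C>0$ such that for all $M$, $G$, $K$ as above and every $p\in(0,1)$, with $T=HK$, $\iota=\log(SAT/p)$ and $b_t=c\sqrt{H^3\iota/t}$, the total regret is at most $$C\sqrt{H^4\,\widetilde{SA}\,T\,\iota}$$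 with probability at least $1-p$. -/

import Mathlib

/-- A tabular episodic MDP with horizon `H`: steps `h = 1, …, H` are indexed by `Fin H`,
transition laws `P h s a` are probability mass functions on the next state, and the
deterministic rewards `r h s a` lie in `[0, 1]`. -/
structure EpisodicMDP (S A : Type*) (H : ℕ) where
  P : Fin H → S → A → PMF S
  r : Fin H → S → A → ℝ
  r_mem : ∀ h s a, r h s a ∈ Set.Icc (0 : ℝ) 1

/-- The states `s_1, …, s_{H+1}` visited in one episode. -/
abbrev Trajectory (S : Type*) (H : ℕ) := Fin (H + 1) → S

/-- A (deterministic, time-dependent) policy. -/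
abbrev Policy (S A : Type*) (H : ℕ) := Fin H → S → A

namespace EpisodicMDP

/-- The law of the first `n + 1` states of an episode in which the initial state has law `μ`
and the policy `π` is followed. -/
noncomputable def prefixLaw {S A : Type*} {H : ℕ} (M : EpisodicMDP S A H)
    (π : Policy S A H) (μ : PMF S) : (n : ℕ) → n ≤ H → PMF (Fin (n + 1) → S)
  | 0, _ => μ.map fun s _ => s
  | n + 1, hn =>
    (prefixLaw M π μ n (Nat.le_of_succ_le hn)).bind fun τ =>
      (M.P ⟨n, hn⟩ (τ (Fin.last n)) (π ⟨n, hn⟩ (τ (Fin.last n)))).map fun s' =>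
        Fin.snoc (α := fun _ => S) τ s'

/-- The law of a whole episode. -/
noncomputable def trajectoryLaw {S A : Type*} {H : ℕ} (M : EpisodicMDP S A H)
    (π : Policy S A H) (μ : PMF S) : PMF (Trajectory S H) :=
  M.prefixLaw π μ H le_rfl

/-- `V_1^π(s)`: the expected total reward of an episode started at `s` under `π`. -/
noncomputable def value {S A : Type*} [Fintype S] {H : ℕ} (M : EpisodicMDP S A H)
    (π : Policy S A H) (s : S) : ℝ :=
  ∑ τ : Trajectory S H, (M.trajectoryLaw π (PMF.pure s) τ).toReal *
    ∑ h : Fin H, M.r h (τ h.castSucc) (π h (τ h.castSucc))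

/-- `V_1^⋆(s)`: the maximum of `V_1^π(s)` over the (finitely many) policies `π`. -/
noncomputable def optimalValue {S A : Type*} [Fintype S] {H : ℕ} (M : EpisodicMDP S A H)
    (s : S) : ℝ :=
  ⨆ π : Policy S A H, M.value π s

/-- The group `G` acts on the MDP: rewards and dynamics are invariant at every step. -/
structure IsSymmetric (G : Type*) {S A : Type*} [Group G] [MulAction G S] [MulAction G A]
    {H : ℕ} (M : EpisodicMDP S A H) : Prop where
  transition : ∀ (g : G) h s a s', M.P h (g • s) (g • a) s' = M.P h s a (g⁻¹ • s')
  reward : ∀ (g : G) h s a, M.r h (g • s) (g • a) = M.r h s a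

end EpisodicMDP

/-- The memory of the tabular learner: `Q_h(s, a)`, the visit counts `N_h(s, a)`, and the value
estimates `V_h(s)` for `h = 1, …, H + 1`. -/
structure QTable (S A : Type*) (H : ℕ) where
  Q : Fin H → S → A → ℝ
  N : Fin H → S → A → ℕ
  V : Fin (H + 1) → S → ℝ

namespace QTable

/-- Initially `Q_h = H`, `N_h = 0`, `V_h = H` for `h ≤ H`, and `V_{H+1} = 0`. -/
noncomputable def initial (S A : Type*) (H : ℕ) : QTable S A H where
  Q := fun _ _ _ => H
  N := fun _ _ _ => 0
  V := Fin.snoc (α := fun _ => S → ℝ) (fun _ _ => (H : ℝ)) (fun _ => 0)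

/-- The learning rate `α_t = (H + 1) / (H + t)`. -/
noncomputable def learningRate (H t : ℕ) : ℝ := ((H : ℝ) + 1) / ((H : ℝ) + t)

open Classical in
/-- The effect of one episode on the memory, with bonuses `b`, when policy `π` is played and the
states `τ` are observed. At step `h` all pairs in the orbit of `(s_h, a_h)` are updated together,
from the values held before the step; step `h` changes only `Q_h`, `N_h`, `V_h` and
reads `V_{h+1}`, which the earlier steps of the episode have not touched. The maximum in the update
of `V_h` is over the updated `Q_h`. -/
noncomputable def update (G : Type*) {S A : Type*} [Group G] [MulAction G S] [MulAction G A]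
    {H : ℕ} (M : EpisodicMDP S A H) (b : ℕ → ℝ) (π : Policy S A H) (τ : Trajectory S H)
    (q : QTable S A H) : QTable S A H :=
  let st : Fin H → S := fun h => τ h.castSucc
  let act : Fin H → A := fun h => π h (st h)
  let orb : Fin H → Set (S × A) := fun h => MulAction.orbit G (st h, act h)
  let Q' : Fin H → S → A → ℝ := fun h s a =>
    if (s, a) ∈ orb h then
      let t := q.N h (st h) (act h) + 1
      (1 - learningRate H t) * q.Q h (st h) (act h) +
        learningRate H t * (M.r h (st h) (act h) + q.V h.succ (τ h.succ) + b t)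
    else q.Q h s a
  { Q := Q'
    N := fun h s a => if (s, a) ∈ orb h then q.N h (st h) (act h) + 1 else q.N h s a
    V := Fin.snoc (α := fun _ => S → ℝ)
      (fun h s => if ∃ a, (s, a) ∈ orb h then min (H : ℝ) (⨆ a', Q' h (st h) a')
        else q.V h.castSucc s)
      (fun _ => 0) }

end QTable

/-- A rule for choosing an action, given the past `k` episodes, the step, the
state, and the current estimates `Q_h(s, ·)`. -/
abbrev ActionRule (S A : Type*) (H : ℕ) :=
  (k : ℕ) → (Fin k → Trajectory S H) → Fin H → S → (A → ℝ) → A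

/-- The rule always selects an element of the `argmax` (ties are broken arbitrarily). -/
def ActionRule.IsGreedy {S A : Type*} {H : ℕ} (rule : ActionRule S A H) : Prop :=
  ∀ k (past : Fin k → Trajectory S H) h s (q : A → ℝ) a', q a' ≤ q (rule k past h s q)

/-- The environment provides the initial state of each episode, possibly at random and possibly
depending on everything that happened in the past episodes. -/
abbrev InitialStateRule (S : Type*) (H : ℕ) :=
  (k : ℕ) → (Fin k → Trajectory S H) → PMF S

namespace QLearning

/-- The memory of the learner after the `k` episodes `past`. -/
noncomputable def table (G : Type*) {S A : Type*} [Group G] [MulAction G S] [MulAction G A]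
    {H : ℕ} (M : EpisodicMDP S A H) (b : ℕ → ℝ) (rule : ActionRule S A H) :
    (k : ℕ) → (Fin k → Trajectory S H) → QTable S A H
  | 0, _ => QTable.initial S A H
  | k + 1, past =>
    let old : Fin k → Trajectory S H := fun i => past i.castSucc
    let q := table G M b rule k old
    QTable.update G M b (fun h s => rule k old h s (q.Q h s)) (past (Fin.last k)) q

/-- The policy played in the episode that follows the `k` episodes `past`. -/
noncomputable def policy (G : Type*) {S A : Type*} [Group G] [MulAction G S] [MulAction G A]
    {H : ℕ} (M : EpisodicMDP S A H) (b : ℕ → ℝ) (rule : ActionRule S A H)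
    (k : ℕ) (past : Fin k → Trajectory S H) : Policy S A H :=
  fun h s => rule k past h s ((table G M b rule k past).Q h s)

/-- The joint law of the first `k` episodes. -/
noncomputable def runLaw (G : Type*) {S A : Type*} [Group G] [MulAction G S] [MulAction G A]
    {H : ℕ} (M : EpisodicMDP S A H) (b : ℕ → ℝ) (rule : ActionRule S A H)
    (start : InitialStateRule S H) : (k : ℕ) → PMF (Fin k → Trajectory S H)
  | 0 => PMF.pure Fin.elim0
  | k + 1 =>
    (runLaw G M b rule start k).bind fun past =>
      (M.trajectoryLaw (policy G M b rule k past) (start k past)).map fun τ =>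
        Fin.snoc (α := fun _ => Trajectory S H) past τ

/-- The total regret `∑_k (V_1^⋆ - V_1^{π^k})(s_1^k)` of a run of `K` episodes. -/
noncomputable def regret (G : Type*) {S A : Type*} [Group G] [MulAction G S] [MulAction G A]
    [Fintype S] {H : ℕ} (M : EpisodicMDP S A H) (b : ℕ → ℝ) (rule : ActionRule S A H)
    {K : ℕ} (ω : Fin K → Trajectory S H) : ℝ :=
  ∑ k : Fin K, (M.optimalValue (ω k 0) -
    M.value (policy G M b rule k (fun i : Fin k => ω (Fin.castLE k.isLt.le i))) (ω k 0))

end QLearning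

/-- `ι = log (S A T / p)`. -/
noncomputable def logFactor (S A : Type*) [Fintype S] [Fintype A] (T : ℕ) (p : ℝ) : ℝ :=
  Real.log ((Fintype.card S : ℝ) * Fintype.card A * T / p)

/-- The number of orbits of state-action pairs under the diagonal action. -/
noncomputable def orbitCount (G S A : Type*) [Group G] [MulAction G S] [MulAction G A] : ℕ :=
  Nat.card (MulAction.orbitRel.Quotient G (S × A))

/-- The UCB-Hoeffding bonus `b_t = c √(H³ ι / t)`. -/
noncomputable def hoeffdingBonus (c : ℝ) (H : ℕ) (ι : ℝ) (t : ℕ) : ℝ :=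
  c * Real.sqrt ((H : ℝ) ^ 3 * ι / t)

/-! This is the analysis of optimistic Q-learning with state-action pairs replaced by orbits. By
invariance the optimal `Q` is constant on orbits (`IsSymmetric.starActionValue_eq`), and so is the
learner's `Q` (`runTable_Q_congr`); hence a visit to an orbit is a legitimate sample for all of its
pairs at once.

Unrolling the updates, after `t ≥ 1` visits the error `Q - Q⋆` is a weighted mean of overestimations
at the next states, plus deviations of `V⋆` from its conditional mean, plus bonuses
(`runTable_Q_sub_starActionValue`). The squared weights sum to at most `2H/t`, so by Azuma–Hoeffding
(`prob_lt_sum_deviation_le`) the deviations are of order `√(H³ι/t)`, which the bonuses cover with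
high probability. On that event the learner is optimistic (`starValue_le_runTable_V`), and the
regret is at most the sum of the gaps `V^k - V^{π^k}`.

Summed over episodes, the gap at step `h` is at most `1 + 1/H` times the gap at step `h + 1`, plus
`H` per orbit, plus bonuses and a martingale (`sum_policyGap_castSucc_le`). The factor `1 + 1/H` is
the bound on the total weight that one visit carries at later times (`sum_learningWeight_left_le`);
its powers up to the horizon stay below `e`. Cauchy–Schwarz over orbits bounds the sum of the
bonuses, which is where the number of orbits enters; the union bound over all pairs affects only
`ι`. -/

open QTable EpisodicMDP

/-! ### Weights produced by the learning rates -/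

/-- The weight `α_t ^ i` that the `i`-th target (counted from `0`) carries after `t` updates with
learning rates `(H + 1) / (H + t)`. -/
noncomputable def learningWeight (H : ℕ) : ℕ → ℕ → ℝ
  | 0, _ => 0
  | t + 1, i => if i = t then learningRate H (t + 1)
      else (1 - learningRate H (t + 1)) * learningWeight H t i

section LearningWeight

variable (H : ℕ)

theorem learningRate_one : learningRate H 1 = 1 := by
  unfold learningRate
  have : (H : ℝ) + 1 ≠ 0 := by positivity
  simp [this]

theorem learningRate_nonneg (t : ℕ) : 0 ≤ learningRate H t := by
  unfold learningRate; positivity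

theorem one_sub_learningRate_succ (t : ℕ) :
    1 - learningRate H (t + 1) = (t : ℝ) / (H + t + 1) := by
  unfold learningRate
  have : (H : ℝ) + t + 1 ≠ 0 := by positivity
  have h' : (H : ℝ) + ((t + 1 : ℕ) : ℝ) ≠ 0 := by positivity
  field_simp
  push_cast
  ring

theorem one_sub_learningRate_succ_nonneg (t : ℕ) : 0 ≤ 1 - learningRate H (t + 1) := by
  rw [one_sub_learningRate_succ]; positivity

theorem learningWeight_self (t : ℕ) :
    learningWeight H (t + 1) t = learningRate H (t + 1) := by
  simp [learningWeight]

theorem learningWeight_succ {t i : ℕ} (h : i ≠ t) :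
    learningWeight H (t + 1) i = (1 - learningRate H (t + 1)) * learningWeight H t i := by
  simp [learningWeight, h]

theorem learningWeight_eq_zero {t i : ℕ} (h : t ≤ i) : learningWeight H t i = 0 := by
  induction t with
  | zero => rfl
  | succ t ih => rw [learningWeight_succ H (by omega), ih (by omega), mul_zero]

theorem learningWeight_nonneg (t i : ℕ) : 0 ≤ learningWeight H t i := by
  induction t with
  | zero => exact le_rfl
  | succ t ih =>
    by_cases h : i = t
    · subst h; rw [learningWeight_self]; exact learningRate_nonneg H _
    · rw [learningWeight_succ H h]
      exact mul_nonneg (one_sub_learningRate_succ_nonneg H t) ih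

theorem sum_learningWeight_succ (y : ℕ → ℝ) (t : ℕ) :
    ∑ i ∈ Finset.range (t + 1), learningWeight H (t + 1) i * y i =
      (1 - learningRate H (t + 1)) * ∑ i ∈ Finset.range t, learningWeight H t i * y i +
        learningRate H (t + 1) * y t := by
  rw [Finset.sum_range_succ, learningWeight_self, Finset.mul_sum]
  congr 1
  refine Finset.sum_congr rfl fun i hi => ?_
  rw [learningWeight_succ H (Finset.mem_range.1 hi).ne, mul_assoc]

theorem sum_learningWeight {t : ℕ} (ht : 1 ≤ t) :
    ∑ i ∈ Finset.range t, learningWeight H t i = 1 := by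
  induction t, ht using Nat.le_induction with
  | base => simp [learningWeight, learningRate_one]
  | succ t ht ih =>
    have := sum_learningWeight_succ H (fun _ => 1) t
    simp only [mul_one, ih] at this
    rw [this]; ring

/-- The newest weight is the largest: `(1 - α_{t+1}) α_t ≤ α_{t+1}` reduces to `t ≤ H + t`. -/
theorem learningWeight_le (t i : ℕ) : learningWeight H t i ≤ learningRate H t := by
  induction t with
  | zero => exact learningRate_nonneg H 0
  | succ t ih =>
    by_cases h : i = t
    · subst h; rw [learningWeight_self]
    · rw [learningWeight_succ H h]
      rcases Nat.eq_zero_or_pos t with rfl | ht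
      · simp [learningRate_one, learningWeight]
      refine (mul_le_mul_of_nonneg_left ih (one_sub_learningRate_succ_nonneg H t)).trans ?_
      rw [one_sub_learningRate_succ]
      unfold learningRate
      have ht' : (0 : ℝ) < t := by exact_mod_cast ht
      have hH : (0 : ℝ) ≤ H := by positivity
      push_cast
      rw [div_mul_div_comm, ← add_assoc, div_le_div_iff₀ (by positivity) (by positivity)]
      have : 0 ≤ (H + 1 : ℝ) * (H + t + 1) * H := by positivity
      nlinarith

theorem sum_learningWeight_sq_le (hH : 1 ≤ H) {t : ℕ} (ht : 1 ≤ t) :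
    ∑ i ∈ Finset.range t, learningWeight H t i ^ 2 ≤ 2 * H / t := by
  calc ∑ i ∈ Finset.range t, learningWeight H t i ^ 2
      ≤ ∑ i ∈ Finset.range t, learningRate H t * learningWeight H t i := by
        refine Finset.sum_le_sum fun i _ => ?_
        rw [sq]
        exact mul_le_mul_of_nonneg_right (learningWeight_le H t i) (learningWeight_nonneg H t i)
    _ = learningRate H t := by rw [← Finset.mul_sum, sum_learningWeight H ht, mul_one]
    _ ≤ 2 * H / t := by
        unfold learningRate
        have hH' : (1 : ℝ) ≤ H := by exact_mod_cast hH
        have ht' : (1 : ℝ) ≤ t := by exact_mod_cast ht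
        rw [div_le_div_iff₀ (by positivity) (by positivity)]
        nlinarith

theorem sum_learningWeight_div_sqrt_le {t : ℕ} (ht : 1 ≤ t) :
    ∑ i ∈ Finset.range t, learningWeight H t i * (1 / √((i + 1 : ℕ) : ℝ)) ≤ 2 / √t := by
  induction t, ht using Nat.le_induction with
  | base => simp [learningWeight, learningRate_one]
  | succ t ht ih =>
    rw [sum_learningWeight_succ]
    have ht' : (0 : ℝ) < t := by exact_mod_cast ht
    refine (add_le_add_left (mul_le_mul_of_nonneg_left ih
      (one_sub_learningRate_succ_nonneg H t)) _).trans ?_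
    rw [one_sub_learningRate_succ]
    unfold learningRate
    push_cast
    set a := √(t : ℝ) with ha
    set b := √((t : ℝ) + 1) with hb
    have ha0 : 0 < a := Real.sqrt_pos.2 ht'
    have hb0 : 0 < b := Real.sqrt_pos.2 (by positivity)
    have ha2 : a ^ 2 = t := Real.sq_sqrt ht'.le
    have hb2 : b ^ 2 = t + 1 := Real.sq_sqrt (by positivity)
    have hH : (0 : ℝ) ≤ H := by positivity
    have key : (t : ℝ) / (H + t + 1) * (2 / a) + (H + 1) / (H + (t + 1)) * (1 / b) =
        (2 * (a * b) + (H + 1)) / ((H + t + 1) * b) := by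
      rw [← ha2]
      field_simp
      ring
    rw [key, div_le_div_iff₀ (by positivity) hb0]
    -- This is `2ab ≤ a² + b²` with `a² = t` and `b² = t + 1`; it is what lets the constant 2
    -- survive the induction.
    have hab : 2 * (a * b) ≤ 2 * t + 1 := by nlinarith [sq_nonneg (a - b)]
    nlinarith [mul_le_mul_of_nonneg_right hab hb0.le]

theorem le_sum_learningWeight_div_sqrt {t : ℕ} (ht : 1 ≤ t) :
    1 / √(t : ℝ) ≤ ∑ i ∈ Finset.range t, learningWeight H t i * (1 / √((i + 1 : ℕ) : ℝ)) := by
  calc 1 / √(t : ℝ) = ∑ i ∈ Finset.range t, learningWeight H t i * (1 / √(t : ℝ)) := by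
        rw [← Finset.sum_mul, sum_learningWeight H ht, one_mul]
    _ ≤ _ := by
        refine Finset.sum_le_sum fun i hi => mul_le_mul_of_nonneg_left ?_
          (learningWeight_nonneg H t i)
        have hi' : i + 1 ≤ t := Finset.mem_range.1 hi
        exact one_div_le_one_div_of_le (Real.sqrt_pos.2 (by positivity))
          (Real.sqrt_le_sqrt (by exact_mod_cast hi'))

/-- This controls how often one overestimation is passed on to later estimates. The partial sum plus
`t/H` times the last weight is constant in `t`, because `(1 + (t+1)/H) · t/(H+t+1) = t/H`. -/
theorem sum_learningWeight_left_le (hH : 1 ≤ H) (n i : ℕ) :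
    ∑ t ∈ Finset.range n, learningWeight H t i ≤ 1 + 1 / H := by
  have hH' : (0 : ℝ) < H := by exact_mod_cast hH
  have key : ∀ m, ∑ t ∈ Finset.range (i + 1 + m + 1), learningWeight H t i +
      ((i + 1 + m : ℕ) : ℝ) / H * learningWeight H (i + 1 + m) i = 1 + 1 / H := by
    intro m
    induction m with
    | zero =>
      rw [add_zero, Finset.sum_range_succ, learningWeight_self, Finset.sum_eq_zero]
      · unfold learningRate
        push_cast
        field_simp
        ring
      · intro t ht
        exact learningWeight_eq_zero H (Nat.lt_succ_iff.1 (Finset.mem_range.1 ht))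
    | succ m ih =>
      rw [← ih, ← add_assoc, Finset.sum_range_succ, learningWeight_succ H (by omega),
        one_sub_learningRate_succ]
      push_cast
      have : (H : ℝ) + (i + 1 + m) + 1 ≠ 0 := by positivity
      field_simp
      ring
  calc ∑ t ∈ Finset.range n, learningWeight H t i
      ≤ ∑ t ∈ Finset.range (i + 1 + n + 1), learningWeight H t i :=
        Finset.sum_le_sum_of_subset_of_nonneg (Finset.range_mono (by omega))
          fun t _ _ => learningWeight_nonneg H t i
    _ ≤ 1 + 1 / H := by
        rw [← key n]
        exact le_add_of_nonneg_right (mul_nonneg (by positivity) (learningWeight_nonneg H _ _))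

end LearningWeight

/-! ### Sums indexed by the visits to an orbit -/

section Visits

variable (p : ℕ → Prop) [DecidablePred p]

theorem sum_ite_count {R : Type*} [AddCommMonoid R] (g : ℕ → R) (k : ℕ) :
    ∑ j ∈ Finset.range k, (if p j then g (Nat.count p j) else 0) =
      ∑ i ∈ Finset.range (Nat.count p k), g i := by
  induction k with
  | zero => simp
  | succ k ih =>
    rw [Finset.sum_range_succ, ih, Nat.count_succ]
    split_ifs with h
    · rw [Finset.sum_range_succ]
    · simp

/-- A quantity that is moved at each visit towards a target, with rate `α_t` at the `t`-th visit,
is a weighted mean of the targets. -/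
theorem eq_sum_learningWeight_of_step (H : ℕ) {E y : ℕ → ℝ}
    (hE : ∀ k, E (k + 1) = if p k then (1 - learningRate H (Nat.count p k + 1)) * E k +
      learningRate H (Nat.count p k + 1) * y k else E k) (k : ℕ) :
    E k = if Nat.count p k = 0 then E 0 else
      ∑ j ∈ Finset.range k,
        (if p j then learningWeight H (Nat.count p k) (Nat.count p j) * y j else 0) := by
  induction k with
  | zero => simp
  | succ k ih =>
    rw [hE]
    by_cases h : p k
    · have hc : Nat.count p (k + 1) = Nat.count p k + 1 := by simp [Nat.count_succ, h]
      rw [if_pos h, hc, if_neg (Nat.succ_ne_zero _), Finset.sum_range_succ, if_pos h,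
        learningWeight_self]
      congr 1
      have hs : ∑ j ∈ Finset.range k, (if p j then
            learningWeight H (Nat.count p k + 1) (Nat.count p j) * y j else 0) =
          (1 - learningRate H (Nat.count p k + 1)) * ∑ j ∈ Finset.range k,
            (if p j then learningWeight H (Nat.count p k) (Nat.count p j) * y j else 0) := by
        rw [Finset.mul_sum]
        refine Finset.sum_congr rfl fun j hj => ?_
        split_ifs with hp
        · rw [learningWeight_succ H (Nat.count_strict_mono hp (Finset.mem_range.1 hj)).ne,
            mul_assoc]
        · rw [mul_zero]
      rw [hs]
      by_cases h0 : Nat.count p k = 0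
      -- At the first visit the rate is 1, so the initial value is forgotten.
      · simp [h0, learningRate_one]
      · rw [ih, if_neg h0]
    · have hc : Nat.count p (k + 1) = Nat.count p k := by simp [Nat.count_succ, h]
      rw [if_neg h, hc, Finset.sum_range_succ, if_neg h, add_zero, ← ih]

/-- Visits from time `k` on have index at least the current count, hence weight zero. -/
theorem sum_learningWeight_count_extend (H : ℕ) (y : ℕ → ℝ) {k K : ℕ} (hk : k ≤ K) :
    ∑ j ∈ Finset.range k,
        (if p j then learningWeight H (Nat.count p k) (Nat.count p j) * y j else 0) =
      ∑ j ∈ Finset.range K,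
        (if p j then learningWeight H (Nat.count p k) (Nat.count p j) * y j else 0) := by
  refine Finset.sum_subset (Finset.range_mono hk) fun j _ hj => ?_
  rw [learningWeight_eq_zero H (Nat.count_monotone p (by simpa using hj)), zero_mul, ite_self]

end Visits

/-- Telescoping of `1/√(m+1) ≤ 2√(m+1) - 2√m`. The term `i = 0` is `1/√0 = 0`, so first visits
contribute nothing here and are charged separately. -/
theorem sum_one_div_sqrt_le (n : ℕ) :
    ∑ i ∈ Finset.range n, 1 / √(i : ℝ) ≤ 2 * √(n : ℝ) := by
  have key : ∀ m : ℕ, ∑ i ∈ Finset.range (m + 1), 1 / √(i : ℝ) ≤ 2 * √(m : ℝ) := by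
    intro m
    induction m with
    | zero => simp
    | succ m ih =>
      rw [Finset.sum_range_succ]
      have hb0 : 0 < √((m + 1 : ℕ) : ℝ) := Real.sqrt_pos.2 (by positivity)
      have hb2 : √((m + 1 : ℕ) : ℝ) ^ 2 = m + 1 := by
        rw [Real.sq_sqrt (by positivity)]; push_cast; rfl
      have ha2 : √(m : ℝ) ^ 2 = m := Real.sq_sqrt (by positivity)
      have : 1 / √((m + 1 : ℕ) : ℝ) ≤ 2 * √((m + 1 : ℕ) : ℝ) - 2 * √(m : ℝ) := by
        rw [div_le_iff₀ hb0]
        nlinarith [sq_nonneg (√((m + 1 : ℕ) : ℝ) - √(m : ℝ))]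
      linarith
  cases n with
  | zero => simp
  | succ n =>
    exact (key n).trans (mul_le_mul_of_nonneg_left
      (Real.sqrt_le_sqrt (by push_cast; linarith)) zero_le_two)

/-! ### Finite expectations, Hoeffding's lemma and the Chernoff bound -/

namespace PMF

/-- The expectation of a real function on a finite probability space. -/
noncomputable def expect {α : Type*} [Fintype α] (p : PMF α) (f : α → ℝ) : ℝ :=
  ∑ x, (p x).toReal * f x

section Expect

variable {α β : Type*} [Fintype α] [Fintype β]

theorem sum_toReal (p : PMF α) : ∑ x, (p x).toReal = 1 := by
  rw [← ENNReal.toReal_sum fun x _ => p.apply_ne_top x, ← tsum_fintype (L := .unconditional α),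
    p.tsum_coe, ENNReal.toReal_one]

theorem expect_const (p : PMF α) (c : ℝ) : p.expect (fun _ => c) = c := by
  rw [expect, ← Finset.sum_mul, p.sum_toReal, one_mul]

theorem expect_mono (p : PMF α) {f g : α → ℝ} (h : ∀ x, f x ≤ g x) : p.expect f ≤ p.expect g :=
  Finset.sum_le_sum fun x _ => mul_le_mul_of_nonneg_left (h x) ENNReal.toReal_nonneg

theorem expect_add (p : PMF α) (f g : α → ℝ) :
    p.expect (fun x => f x + g x) = p.expect f + p.expect g := by
  simp only [expect, mul_add, Finset.sum_add_distrib]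

theorem expect_sub (p : PMF α) (f g : α → ℝ) :
    p.expect (fun x => f x - g x) = p.expect f - p.expect g := by
  simp only [expect, mul_sub, Finset.sum_sub_distrib]

theorem expect_const_mul (p : PMF α) (c : ℝ) (f : α → ℝ) :
    p.expect (fun x => c * f x) = c * p.expect f := by
  simp only [expect, Finset.mul_sum]
  exact Finset.sum_congr rfl fun x _ => by ring

theorem expect_pure (a : α) (f : α → ℝ) : (PMF.pure a).expect f = f a := by
  classical
  simp only [expect, PMF.pure_apply]
  rw [Finset.sum_eq_single a]
  · simp
  · intro b _ hb; simp [hb]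
  · simp

theorem expect_bind (p : PMF α) (q : α → PMF β) (f : β → ℝ) :
    (p.bind q).expect f = p.expect fun x => (q x).expect f := by
  simp only [expect, PMF.bind_apply, Finset.mul_sum]
  rw [Finset.sum_comm]
  refine Finset.sum_congr rfl fun y _ => ?_
  rw [tsum_fintype, ENNReal.toReal_sum fun x _ =>
    ENNReal.mul_ne_top (p.apply_ne_top x) ((q x).apply_ne_top y), Finset.sum_mul]
  refine Finset.sum_congr rfl fun x _ => ?_
  rw [ENNReal.toReal_mul, mul_assoc]

theorem expect_map (p : PMF α) (g : α → β) (f : β → ℝ) :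
    (p.map g).expect f = p.expect fun x => f (g x) := by
  rw [← PMF.bind_pure_comp, expect_bind]
  simp only [Function.comp, expect_pure]

/-- Hoeffding's lemma. -/
theorem expect_exp_le_one (p : PMF α) {B : ℝ} (hB : 0 < B) {f : α → ℝ}
    (hf : ∀ x, f x ∈ Set.Icc 0 B) (c : ℝ) :
    p.expect (fun x => Real.exp (c * (f x - p.expect f) - c ^ 2 * B ^ 2 / 2)) ≤ 1 := by
  set m := p.expect f with hm
  have hm0 : 0 ≤ m := by
    rw [← p.expect_const 0]; exact p.expect_mono fun x => (hf x).1
  have hmB : m ≤ B := by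
    rw [← p.expect_const B]; exact p.expect_mono fun x => (hf x).2
  -- Since `|f x - m| ≤ B`, convexity puts `exp` below its chord on `[-cB, cB]`; the linear part has
  -- mean zero and only `cosh` remains.
  have key : ∀ x, Real.exp (c * (f x - m)) ≤
      Real.cosh (c * B) + Real.sinh (c * B) / B * (f x - m) := by
    intro x
    have hx := hf x
    have h1 : 0 ≤ (B + (f x - m)) / (2 * B) := div_nonneg (by linarith [hx.1]) (by linarith)
    have h2 : 0 ≤ (B - (f x - m)) / (2 * B) := div_nonneg (by linarith [hx.2]) (by linarith)
    have h3 : (B + (f x - m)) / (2 * B) + (B - (f x - m)) / (2 * B) = 1 := by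
      field_simp; ring
    have := convexOn_exp.2 (Set.mem_univ (c * B)) (Set.mem_univ (-(c * B))) h1 h2 h3
    simp only [smul_eq_mul] at this
    have h4 : (B + (f x - m)) / (2 * B) * (c * B) + (B - (f x - m)) / (2 * B) * -(c * B) =
        c * (f x - m) := by
      field_simp; ring
    rw [h4] at this
    refine this.trans_eq ?_
    rw [Real.cosh_eq, Real.sinh_eq]
    generalize Real.exp (c * B) = a
    generalize Real.exp (-(c * B)) = a'
    field_simp
    ring
  calc p.expect (fun x => Real.exp (c * (f x - m) - c ^ 2 * B ^ 2 / 2))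
      ≤ p.expect (fun x => Real.exp (-(c ^ 2 * B ^ 2 / 2)) *
          (Real.cosh (c * B) + Real.sinh (c * B) / B * (f x - m))) := by
        refine p.expect_mono fun x => ?_
        rw [sub_eq_neg_add, Real.exp_add]
        exact mul_le_mul_of_nonneg_left (key x) (Real.exp_pos _).le
    _ = Real.exp (-(c ^ 2 * B ^ 2 / 2)) * Real.cosh (c * B) := by
        rw [expect_const_mul, expect_add, expect_const, expect_const_mul, expect_sub,
          expect_const, ← hm, sub_self, mul_zero, add_zero]
    _ ≤ Real.exp (-(c ^ 2 * B ^ 2 / 2)) * Real.exp ((c * B) ^ 2 / 2) :=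
        mul_le_mul_of_nonneg_left (Real.cosh_le_exp_half_sq _) (Real.exp_pos _).le
    _ = 1 := by rw [← Real.exp_add, mul_pow, neg_add_cancel, Real.exp_zero]

open Classical in
/-- The probability of an event, as a real number. -/
noncomputable def prob (p : PMF α) (s : Set α) : ℝ :=
  p.expect fun x => if x ∈ s then 1 else 0

theorem prob_mono (p : PMF α) {s t : Set α} (h : s ⊆ t) : p.prob s ≤ p.prob t := by
  classical
  refine p.expect_mono fun x => ?_
  by_cases hx : x ∈ s
  · simp [hx, h hx]
  · simp only [hx, if_false]; split_ifs <;> norm_num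

theorem prob_union_le (p : PMF α) (s t : Set α) : p.prob (s ∪ t) ≤ p.prob s + p.prob t := by
  classical
  unfold prob
  rw [← expect_add]
  refine p.expect_mono fun x => ?_
  by_cases hs : x ∈ s <;> by_cases ht : x ∈ t <;> simp [hs, ht]

theorem prob_iUnion_le {γ : Type*} [Fintype γ] (p : PMF α) (s : γ → Set α) :
    p.prob (⋃ i, s i) ≤ ∑ i, p.prob (s i) := by
  classical
  have : ∑ i, p.prob (s i) = p.expect fun x => ∑ i, if x ∈ s i then (1 : ℝ) else 0 := by
    simp only [prob, expect, Finset.mul_sum]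
    exact Finset.sum_comm
  rw [this]
  refine p.expect_mono fun x => ?_
  have h0 : ∀ i ∈ Finset.univ, (0 : ℝ) ≤ if x ∈ s i then 1 else 0 := fun i _ => by
    split_ifs <;> norm_num
  split_ifs with hx
  · obtain ⟨i, hi⟩ := Set.mem_iUnion.1 hx
    refine le_trans ?_ (Finset.single_le_sum h0 (Finset.mem_univ i))
    simp [hi]
  · exact Finset.sum_nonneg h0

theorem ofReal_one_sub_le_toOuterMeasure (p : PMF α) {s : Set α} {ε : ℝ} (h : p.prob sᶜ ≤ ε) :
    ENNReal.ofReal (1 - ε) ≤ p.toOuterMeasure s := by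
  classical
  have h1 : p.prob s + p.prob sᶜ = 1 := by
    unfold prob
    rw [← expect_add]
    refine Eq.trans ?_ (p.expect_const 1)
    congr 1
    ext x
    by_cases hx : x ∈ s <;> simp [hx]
  have h2 : p.toOuterMeasure s = ENNReal.ofReal (p.prob s) := by
    rw [PMF.toOuterMeasure_apply_fintype, prob, expect,
      ENNReal.ofReal_sum_of_nonneg fun x _ => mul_nonneg ENNReal.toReal_nonneg
        (by split_ifs <;> norm_num)]
    refine Finset.sum_congr rfl fun x _ => ?_
    by_cases hx : x ∈ s
    · simp [hx, ENNReal.ofReal_toReal (p.apply_ne_top x)]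
    · simp [hx]
  rw [h2]
  exact ENNReal.ofReal_le_ofReal (by linarith)

/-- The Chernoff bound. -/
theorem prob_lt_le_exp (p : PMF α) {X : α → ℝ} {v : ℝ} (hv : 0 < v)
    (hX : ∀ l : ℝ, p.expect (fun x => Real.exp (l * X x - l ^ 2 * v)) ≤ 1) {ε : ℝ}
    (hε : 0 ≤ ε) : p.prob {x | ε < X x} ≤ Real.exp (-(ε ^ 2 / (4 * v))) := by
  classical
  -- This choice minimises `l² v - l ε`, with minimum `-ε²/(4v)`.
  set l := ε / (2 * v) with hl
  have hl0 : 0 ≤ l := by positivity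
  calc p.prob {x | ε < X x}
      ≤ p.expect (fun x => Real.exp (-(ε ^ 2 / (4 * v))) * Real.exp (l * X x - l ^ 2 * v)) := by
        refine p.expect_mono fun x => ?_
        split_ifs with hx
        · rw [← Real.exp_add, Real.one_le_exp_iff]
          have h1 : l * ε ≤ l * X x := mul_le_mul_of_nonneg_left (le_of_lt hx) hl0
          have h2 : -(ε ^ 2 / (4 * v)) + (l * ε - l ^ 2 * v) = 0 := by
            rw [hl]; field_simp; ring
          linarith
        · positivity
    _ ≤ _ := by
        rw [expect_const_mul]
        exact mul_le_of_le_one_right (Real.exp_pos _).le (hX l)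

end Expect

end PMF

/-! ### Exponential supermartingales along episodes and runs -/

namespace EpisodicMDP

variable {S A : Type*} [Fintype S] {H : ℕ} (M : EpisodicMDP S A H)

/-- If every transition contributes a factor of conditional mean at most `1`, then so does the
whole episode. -/
theorem expect_trajectoryLaw_exp_le_one (π : Policy S A H) (μ : PMF S) (u : Fin H → S → S → ℝ)
    (hu : ∀ h s, (M.P h s (π h s)).expect (fun s' => Real.exp (u h s s')) ≤ 1) :
    (M.trajectoryLaw π μ).expect
      (fun τ => Real.exp (∑ h : Fin H, u h (τ h.castSucc) (τ h.succ))) ≤ 1 := by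
  have key : ∀ n (hn : n ≤ H), (M.prefixLaw π μ n hn).expect (fun τ => Real.exp
      (∑ h : Fin n, u (h.castLE hn) (τ h.castSucc) (τ h.succ))) ≤ 1 := by
    intro n
    induction n with
    | zero => intro hn; simp [PMF.expect_const]
    | succ n ih =>
      intro hn
      refine le_trans ?_ (ih (Nat.le_of_succ_le hn))
      rw [prefixLaw, PMF.expect_bind]
      refine PMF.expect_mono _ fun τ => ?_
      rw [PMF.expect_map]
      simp only [Fin.sum_univ_castSucc, Real.exp_add, Fin.snoc_castSucc, Fin.succ_last,
        Fin.snoc_last, Fin.succ_castSucc, PMF.expect_const_mul]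
      exact mul_le_of_le_one_right (Real.exp_pos _).le (hu ⟨n, hn⟩ (τ (Fin.last n)))
  exact key H le_rfl

end EpisodicMDP

/-- The same supermartingale argument one level up: given the past, the policy is fixed and the
factor of the last episode has mean at most 1. -/
theorem QLearning.expect_runLaw_exp_le_one (G : Type*) {S A : Type*} [Group G] [MulAction G S]
    [MulAction G A] [Fintype S] {H : ℕ} (M : EpisodicMDP S A H) (b : ℕ → ℝ)
    (rule : ActionRule S A H) (start : InitialStateRule S H)
    (U : (k : ℕ) → (Fin k → Trajectory S H) → Trajectory S H → ℝ)
    (hU : ∀ k past, (M.trajectoryLaw (policy G M b rule k past) (start k past)).expect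
      (fun τ => Real.exp (U k past τ)) ≤ 1) (K : ℕ) :
    (runLaw G M b rule start K).expect (fun ω => Real.exp
      (∑ k : Fin K, U k (fun i => ω (Fin.castLE k.isLt.le i)) (ω k))) ≤ 1 := by
  induction K with
  | zero => simp [PMF.expect_const]
  | succ K ih =>
    refine le_trans ?_ ih
    rw [runLaw, PMF.expect_bind]
    refine PMF.expect_mono _ fun past => ?_
    rw [PMF.expect_map]
    have h1 : ∀ (τ : Trajectory S H) (k : Fin K) (i : Fin k),
        Fin.snoc (α := fun _ => Trajectory S H)
        past τ (Fin.castLE k.castSucc.isLt.le i) = past (Fin.castLE k.isLt.le i) := by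
      intro τ k i
      exact Fin.snoc_castSucc (α := fun _ => Trajectory S H) τ past (Fin.castLE k.isLt.le i)
    have h2 : ∀ (τ : Trajectory S H) (i : Fin K), Fin.snoc (α := fun _ => Trajectory S H)
        past τ (Fin.castLE (Fin.last K).isLt.le i) = past i := by
      intro τ i
      exact Fin.snoc_castSucc (α := fun _ => Trajectory S H) τ past i
    have h3 : ∀ τ : Trajectory S H, ∑ k : Fin (K + 1), U k (fun i => Fin.snoc
          (α := fun _ => Trajectory S H) past τ (Fin.castLE k.isLt.le i))
          (Fin.snoc (α := fun _ => Trajectory S H) past τ k) =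
        ∑ k : Fin K, U k (fun i => past (Fin.castLE k.isLt.le i)) (past k) + U K past τ := by
      intro τ
      rw [Fin.sum_univ_castSucc]
      congr 1
      · refine Finset.sum_congr rfl fun k _ => ?_
        rw [Fin.snoc_castSucc]
        exact congrArg (fun x => U k x (past k)) (funext (h1 τ k))
      · rw [Fin.snoc_last]
        exact congrArg (fun x => U K x τ) (funext (h2 τ))
    simp only [h3, Real.exp_add, PMF.expect_const_mul]
    exact mul_le_of_le_one_right (Real.exp_pos _).le (hU K past)

/-! ### Bellman equations -/

namespace EpisodicMDP

section Values

variable {S A : Type*} [Fintype S] {H : ℕ} (M : EpisodicMDP S A H)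

/-- The conditional expectation `P_h v (s, a)` of `v` at the next state. -/
noncomputable def transition (h : Fin H) (v : S → ℝ) (s : S) (a : A) : ℝ :=
  (M.P h s a).expect v

/-- The value `V_h^π` for every step `h`, by backward recursion. -/
noncomputable def policyValue (π : Policy S A H) : Fin (H + 1) → S → ℝ :=
  Fin.reverseInduction (motive := fun _ => S → ℝ) (fun _ => 0) fun h v s =>
    M.r h s (π h s) + M.transition h v s (π h s)

/-- The solution `V_h^⋆` of the Bellman optimality equations. -/
noncomputable def starValue : Fin (H + 1) → S → ℝ :=
  Fin.reverseInduction (motive := fun _ => S → ℝ) (fun _ => 0) fun h v s =>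
    ⨆ a, M.r h s a + M.transition h v s a

/-- The optimal state-action values `Q_h^⋆`. -/
noncomputable def starActionValue (h : Fin H) (s : S) (a : A) : ℝ :=
  M.r h s a + M.transition h (M.starValue h.succ) s a

@[simp] theorem policyValue_last (π : Policy S A H) (s : S) :
    M.policyValue π (Fin.last H) s = 0 := by
  simp [policyValue]

theorem policyValue_castSucc (π : Policy S A H) (h : Fin H) (s : S) :
    M.policyValue π h.castSucc s =
      M.r h s (π h s) + M.transition h (M.policyValue π h.succ) s (π h s) := by
  simp only [policyValue, Fin.reverseInduction_castSucc]

@[simp] theorem starValue_last (s : S) : M.starValue (Fin.last H) s = 0 := by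
  simp [starValue]

theorem starValue_castSucc (h : Fin H) (s : S) :
    M.starValue h.castSucc s = ⨆ a, M.starActionValue h s a := by
  simp only [starValue, starActionValue, Fin.reverseInduction_castSucc]

theorem transition_mono (h : Fin H) {v w : S → ℝ} (hvw : ∀ s, v s ≤ w s) (s : S) (a : A) :
    M.transition h v s a ≤ M.transition h w s a :=
  PMF.expect_mono _ hvw

theorem transition_sub (h : Fin H) (v w : S → ℝ) (s : S) (a : A) :
    M.transition h (fun s => v s - w s) s a = M.transition h v s a - M.transition h w s a :=
  PMF.expect_sub _ _ _

theorem transition_const (h : Fin H) (c : ℝ) (s : S) (a : A) :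
    M.transition h (fun _ => c) s a = c :=
  PMF.expect_const _ _

theorem transition_nonneg (h : Fin H) {v : S → ℝ} (hv : ∀ s, 0 ≤ v s) (s : S) (a : A) :
    0 ≤ M.transition h v s a :=
  (M.transition_const h 0 s a).symm.trans_le (M.transition_mono h hv s a)

theorem transition_le (h : Fin H) {v : S → ℝ} {c : ℝ} (hv : ∀ s, v s ≤ c) (s : S) (a : A) :
    M.transition h v s a ≤ c :=
  (M.transition_mono h hv s a).trans_eq (M.transition_const h c s a)

theorem value_eq_policyValue (π : Policy S A H) (s : S) :
    M.value π s = M.policyValue π 0 s := by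
  -- The reward collected so far plus the value at the current state is a martingale, so its mean
  -- does not depend on `n`.
  have key : ∀ n (hn : n ≤ H), (M.prefixLaw π (PMF.pure s) n hn).expect (fun τ =>
      ∑ h : Fin n, M.r (h.castLE hn) (τ h.castSucc) (π (h.castLE hn) (τ h.castSucc)) +
        M.policyValue π ⟨n, Nat.lt_succ_of_le hn⟩ (τ (Fin.last n))) = M.policyValue π 0 s := by
    intro n
    induction n with
    | zero =>
      intro hn
      rw [prefixLaw, PMF.expect_map, PMF.expect_pure]
      simp
    | succ n ih =>
      intro hn
      rw [← ih (Nat.le_of_succ_le hn), prefixLaw, PMF.expect_bind]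
      congr 1
      ext τ
      rw [PMF.expect_map]
      simp only [Fin.sum_univ_castSucc, Fin.snoc_castSucc, Fin.snoc_last, PMF.expect_add,
        PMF.expect_const, add_assoc]
      congr 1
      exact (M.policyValue_castSucc π ⟨n, hn⟩ (τ (Fin.last n))).symm
  rw [← key H le_rfl]
  unfold value trajectoryLaw PMF.expect
  refine Finset.sum_congr rfl fun τ _ => ?_
  have : M.policyValue π ⟨H, Nat.lt_succ_of_le le_rfl⟩ (τ (Fin.last H)) = 0 :=
    M.policyValue_last π _
  dsimp only
  rw [this, add_zero]
  rfl

theorem policyValue_nonneg (π : Policy S A H) (h : Fin (H + 1)) (s : S) :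
    0 ≤ M.policyValue π h s := by
  induction h using Fin.reverseInduction generalizing s with
  | last => simp
  | cast h ih =>
    rw [policyValue_castSucc]
    exact add_nonneg (M.r_mem h _ _).1 (M.transition_nonneg h ih _ _)

theorem starValue_le_sub [Nonempty A] (h : Fin (H + 1)) (s : S) :
    M.starValue h s ≤ (H : ℝ) - h := by
  induction h using Fin.reverseInduction generalizing s with
  | last => simp
  | cast h ih =>
    rw [starValue_castSucc]
    refine ciSup_le fun a => ?_
    have h1 := M.transition_le h ih s a
    have h2 := (M.r_mem h s a).2
    rw [Fin.val_succ] at h1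
    push_cast at h1
    rw [starActionValue, Fin.val_castSucc]
    linarith

variable [Finite A]

theorem starActionValue_le_starValue (h : Fin H) (s : S) (a : A) :
    M.starActionValue h s a ≤ M.starValue h.castSucc s := by
  rw [starValue_castSucc]
  exact le_ciSup (Set.finite_range _).bddAbove a

theorem policyValue_le_starValue (π : Policy S A H) (h : Fin (H + 1)) (s : S) :
    M.policyValue π h s ≤ M.starValue h s := by
  induction h using Fin.reverseInduction generalizing s with
  | last => simp
  | cast h ih =>
    rw [policyValue_castSucc]
    refine le_trans ?_ (M.starActionValue_le_starValue h s (π h s))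
    exact add_le_add_right (M.transition_mono h ih _ _) _

/-- Only this direction is needed: the regret is bounded against the Bellman solution. -/
theorem optimalValue_le_starValue [Nonempty A] (s : S) :
    M.optimalValue s ≤ M.starValue 0 s :=
  ciSup_le fun π => (M.value_eq_policyValue π s).trans_le (M.policyValue_le_starValue π 0 s)

theorem starValue_mem_Icc [Nonempty A] (h : Fin (H + 1)) (s : S) :
    M.starValue h s ∈ Set.Icc (0 : ℝ) H := by
  refine ⟨?_, (M.starValue_le_sub h s).trans (sub_le_self _ (Nat.cast_nonneg _))⟩
  exact (M.policyValue_nonneg (fun _ _ => Classical.arbitrary A) h s).trans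
    (M.policyValue_le_starValue _ h s)

theorem starActionValue_nonneg [Nonempty A] (h : Fin H) (s : S) (a : A) :
    0 ≤ M.starActionValue h s a :=
  add_nonneg (M.r_mem h s a).1
    (M.transition_nonneg h (fun s' => (M.starValue_mem_Icc h.succ s').1) s a)

end Values

/-! ### Invariance of the optimal values -/

section Symmetry

variable {G S A : Type*} [Fintype S] [Group G] [MulAction G S] [MulAction G A] {H : ℕ}
  {M : EpisodicMDP S A H}

theorem IsSymmetric.transition_smul (hM : M.IsSymmetric G) (h : Fin H) {v : S → ℝ}
    (hv : ∀ (g : G) s, v (g • s) = v s) (g : G) (s : S) (a : A) :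
    M.transition h v (g • s) (g • a) = M.transition h v s a := by
  unfold EpisodicMDP.transition PMF.expect
  rw [← Equiv.sum_comp (MulAction.toPerm g)]
  refine Finset.sum_congr rfl fun s' _ => ?_
  rw [MulAction.toPerm_apply, hM.transition, inv_smul_smul, hv]

/-- Backward induction: `g` permutes the actions, which leaves the supremum unchanged, and permutes
the next states, on which the later value is invariant. -/
theorem IsSymmetric.starValue_smul (hM : M.IsSymmetric G) (h : Fin (H + 1)) (g : G) (s : S) :
    M.starValue h (g • s) = M.starValue h s := by
  induction h using Fin.reverseInduction generalizing g s with
  | last => simp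
  | cast h ih =>
    rw [starValue_castSucc, starValue_castSucc, ← Equiv.iSup_comp (MulAction.toPerm g)]
    refine iSup_congr fun a => ?_
    rw [MulAction.toPerm_apply, starActionValue, starActionValue, hM.reward,
      hM.transition_smul h ih]

theorem IsSymmetric.starActionValue_eq (hM : M.IsSymmetric G) (h : Fin H) {s s' : S} {a a' : A}
    (hs : (s, a) ∈ MulAction.orbit G (s', a')) :
    M.starActionValue h s a = M.starActionValue h s' a' := by
  obtain ⟨g, hg⟩ := hs
  obtain ⟨rfl, rfl⟩ := Prod.mk.inj hg
  rw [starActionValue, starActionValue]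
  exact congrArg₂ _ (hM.reward _ _ _ _) (hM.transition_smul h (hM.starValue_smul h.succ) _ _ _)

end Symmetry

end EpisodicMDP

/-! ### The tables along a run -/

namespace QLearning

section Run

variable (G : Type*) {S A : Type*} [Group G] [MulAction G S] [MulAction G A]
  {H : ℕ} (M : EpisodicMDP S A H) (b : ℕ → ℝ) (rule : ActionRule S A H)
  (ω : ℕ → Trajectory S H)

/-- The memory after `k` episodes of an infinite sequence of episodes. -/
noncomputable def runTable (k : ℕ) : QTable S A H :=
  table G M b rule k fun i : Fin k => ω i

/-- The policy played in episode `k` of an infinite sequence of episodes. -/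
noncomputable def runPolicy (k : ℕ) : Policy S A H :=
  policy G M b rule k fun i : Fin k => ω i

/-- The action taken at step `h` of episode `k`. -/
noncomputable def runAction (k : ℕ) (h : Fin H) : A :=
  runPolicy G M b rule ω k h (ω k h.castSucc)

/-- The orbit of `(s, a)` is met at step `h` of episode `k`. -/
def Visits (h : Fin H) (s : S) (a : A) (k : ℕ) : Prop :=
  (s, a) ∈ MulAction.orbit G (ω k h.castSucc, runAction G M b rule ω k h)

open Classical in
/-- The number of episodes before `k` in which the orbit of `(s, a)` is met at step `h`. -/
noncomputable def visitCount (h : Fin H) (s : S) (a : A) (k : ℕ) : ℕ :=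
  Nat.count (Visits G M b rule ω h s a) k

theorem runTable_succ (k : ℕ) : runTable G M b rule ω (k + 1) =
    QTable.update G M b (runPolicy G M b rule ω k) (ω k) (runTable G M b rule ω k) :=
  rfl

variable {G}

theorem visits_congr {h : Fin H} {s s' : S} {a a' : A}
    (hs : (s, a) ∈ MulAction.orbit G (s', a')) :
    Visits G M b rule ω h s a = Visits G M b rule ω h s' a' := by
  ext k
  unfold Visits
  have h1 := MulAction.orbit_eq_iff.2 hs
  rw [← MulAction.orbit_eq_iff, ← MulAction.orbit_eq_iff, h1]

theorem visitCount_congr {h : Fin H} {s s' : S} {a a' : A}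
    (hs : (s, a) ∈ MulAction.orbit G (s', a')) :
    visitCount G M b rule ω h s a = visitCount G M b rule ω h s' a' := by
  classical
  ext k
  unfold visitCount
  simp only [visits_congr M b rule ω hs]

theorem runTable_N (k : ℕ) (h : Fin H) (s : S) (a : A) :
    (runTable G M b rule ω k).N h s a = visitCount G M b rule ω h s a k := by
  classical
  induction k generalizing s a with
  | zero => simp [runTable, table, QTable.initial, visitCount]
  | succ k ih =>
    rw [runTable_succ, visitCount, Nat.count_succ]
    change (if Visits G M b rule ω h s a k then _ + 1 else _) = _
    split_ifs with hv
    · have := ih (ω k h.castSucc) (runAction G M b rule ω k h)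
      rw [← visitCount_congr M b rule ω hv] at this
      exact congrArg (· + 1) this
    · exact ih s a

theorem runTable_Q_succ (k : ℕ) (h : Fin H) (s : S) (a : A)
    [Decidable (Visits G M b rule ω h s a k)] :
    (runTable G M b rule ω (k + 1)).Q h s a =
      if Visits G M b rule ω h s a k then
        (1 - QTable.learningRate H (visitCount G M b rule ω h s a k + 1)) *
            (runTable G M b rule ω k).Q h (ω k h.castSucc) (runAction G M b rule ω k h) +
          QTable.learningRate H (visitCount G M b rule ω h s a k + 1) *
            (M.r h (ω k h.castSucc) (runAction G M b rule ω k h) +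
              (runTable G M b rule ω k).V h.succ (ω k h.succ) +
              b (visitCount G M b rule ω h s a k + 1))
      else (runTable G M b rule ω k).Q h s a := by
  rw [runTable_succ]
  split_ifs with hv
  · rw [visitCount_congr M b rule ω hv, ← runTable_N]
    exact if_pos hv
  · exact if_neg hv

theorem runTable_Q_congr (k : ℕ) {h : Fin H} {s s' : S} {a a' : A}
    (hs : (s, a) ∈ MulAction.orbit G (s', a')) :
    (runTable G M b rule ω k).Q h s a = (runTable G M b rule ω k).Q h s' a' := by
  classical
  induction k with
  | zero => rfl
  | succ k ih =>
    rw [runTable_Q_succ, runTable_Q_succ, ih]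
    simp only [visits_congr M b rule ω hs, visitCount_congr M b rule ω hs]

theorem runTable_V_last (k : ℕ) (s : S) :
    (runTable G M b rule ω k).V (Fin.last H) s = 0 := by
  cases k with
  | zero => simp [runTable, table, QTable.initial]
  | succ k => simp [runTable_succ, QTable.update]

/-- The update copies the maximum at `s_h` to every state `g • s_h`; as `Q` is constant on orbits,
`g` permutes the actions and the maximum is the same. At the other states no `Q` value has changed.
-/
theorem runTable_V_castSucc [Nonempty A] (k : ℕ) (h : Fin H) (s : S) :
    (runTable G M b rule ω k).V h.castSucc s =
      min (H : ℝ) (⨆ a, (runTable G M b rule ω k).Q h s a) := by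
  classical
  induction k with
  | zero => simp [runTable, table, QTable.initial]
  | succ k ih =>
    have h1 : (runTable G M b rule ω (k + 1)).V h.castSucc s =
        if ∃ a, Visits G M b rule ω h s a k then
          min (H : ℝ) (⨆ a, (runTable G M b rule ω (k + 1)).Q h (ω k h.castSucc) a)
        else (runTable G M b rule ω k).V h.castSucc s := by
      rw [runTable_succ]
      simp only [QTable.update, Fin.snoc_castSucc]
      rfl
    rw [h1]
    split_ifs with hv
    · obtain ⟨a, g, hg⟩ := hv
      obtain ⟨rfl, -⟩ := Prod.mk.inj hg
      congr 1
      refine Eq.trans (iSup_congr fun a => ?_) ((MulAction.toPerm g).iSup_comp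
        (g := fun a => (runTable G M b rule ω (k + 1)).Q h (g • ω k h.castSucc) a))
      exact (runTable_Q_congr M b rule ω (k + 1) ⟨g, rfl⟩).symm
    · push Not at hv
      rw [ih]
      congr 1
      refine iSup_congr fun a => ?_
      rw [runTable_Q_succ, if_neg (hv a)]

theorem runTable_Q_of_visitCount_eq_zero {k : ℕ} {h : Fin H} {s : S} {a : A}
    (h0 : visitCount G M b rule ω h s a k = 0) : (runTable G M b rule ω k).Q h s a = H := by
  classical
  induction k with
  | zero => rfl
  | succ k ih =>
    rw [visitCount, Nat.count_succ] at h0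
    rw [runTable_Q_succ, if_neg fun hv => by simp [hv] at h0]
    exact ih (by unfold visitCount; omega)

variable [Fintype S]

/-- The deviation of `V_{h+1}^⋆` at the observed next state from its conditional mean. -/
noncomputable def starNoise (G : Type*) [Group G] [MulAction G S] [MulAction G A]
    (h : Fin H) (k : ℕ) : ℝ :=
  M.starValue h.succ (ω k h.succ) -
    M.transition h (M.starValue h.succ) (ω k h.castSucc) (runAction G M b rule ω k h)

/-- The overestimation `V_{h+1}^k - V_{h+1}^⋆` at the observed next state. -/
noncomputable def nextGap (G : Type*) [Group G] [MulAction G S] [MulAction G A]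
    (h : Fin (H + 1)) (k : ℕ) : ℝ :=
  (runTable G M b rule ω k).V h (ω k h) - M.starValue h (ω k h)

variable {M}

open Classical in
-- By the Bellman equation at the visited pair, the target minus `Q⋆` is overestimation plus
-- deviation plus bonus; the orbit shares both `Q` and `Q⋆`, so the error itself follows the
-- averaging recursion.
theorem runTable_Q_sub_starActionValue (hM : M.IsSymmetric G) {k : ℕ} {h : Fin H} {s : S} {a : A}
    (h0 : visitCount G M b rule ω h s a k ≠ 0) :
    (runTable G M b rule ω k).Q h s a - M.starActionValue h s a =
      ∑ j ∈ Finset.range k, if Visits G M b rule ω h s a j then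
        learningWeight H (visitCount G M b rule ω h s a k) (visitCount G M b rule ω h s a j) *
          (nextGap M b rule ω G h.succ j + starNoise M b rule ω G h j +
            b (visitCount G M b rule ω h s a j + 1)) else 0 := by
  refine (eq_sum_learningWeight_of_step (Visits G M b rule ω h s a) H
    (E := fun k => (runTable G M b rule ω k).Q h s a - M.starActionValue h s a)
    (fun k => ?_) k).trans (if_neg h0)
  rw [runTable_Q_succ]
  split_ifs with hv
  · have h1 := hM.starActionValue_eq h hv
    have h2 := runTable_Q_congr M b rule ω k (h := h) hv
    rw [← h2, h1]
    unfold nextGap starNoise visitCount starActionValue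
    ring
  · rfl

end Run

end QLearning

/-! ### Sums over episodes grouped by orbit -/

section LabelledSequence

variable {O : Type*} [Fintype O] [DecidableEq O] (o : ℕ → O)

theorem sum_count_label {R : Type*} [AddCommMonoid R] (g : ℕ → R) (K : ℕ) :
    ∑ k ∈ Finset.range K, g (Nat.count (fun j => o j = o k) k) =
      ∑ x, ∑ i ∈ Finset.range (Nat.count (fun j => o j = x) K), g i := by
  simp only [← sum_ite_count]
  rw [Finset.sum_comm]
  refine Finset.sum_congr rfl fun k _ => ?_
  rw [Finset.sum_ite_eq]
  simp

/-- Each label occurs for the first time at most once. -/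
theorem sum_count_label_eq_zero_le (K : ℕ) :
    ∑ k ∈ Finset.range K, (if Nat.count (fun j => o j = o k) k = 0 then (1 : ℝ) else 0) ≤
      Fintype.card O := by
  rw [sum_count_label o (fun n => if n = 0 then (1 : ℝ) else 0), Fintype.card_eq_sum_ones,
    Nat.cast_sum]
  refine Finset.sum_le_sum fun x _ => ?_
  rw [Finset.sum_ite_eq']
  split_ifs <;> simp

/-- Cauchy–Schwarz over the labels, whose counts add up to `K`. -/
theorem sum_one_div_sqrt_count_label_le (K : ℕ) :
    ∑ k ∈ Finset.range K, 1 / √(Nat.count (fun j => o j = o k) k : ℝ) ≤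
      2 * √(Fintype.card O * K) := by
  rw [sum_count_label o (fun n => 1 / √(n : ℝ))]
  have h1 : ∑ x, (Nat.count (fun j => o j = x) K : ℝ) = K := by
    have := sum_count_label o (fun _ => (1 : ℝ)) K
    simpa using this.symm
  calc ∑ x, ∑ i ∈ Finset.range (Nat.count (fun j => o j = x) K), 1 / √(i : ℝ)
      ≤ ∑ x, 2 * √(Nat.count (fun j => o j = x) K : ℝ) :=
        Finset.sum_le_sum fun x _ => sum_one_div_sqrt_le _
    _ = 2 * ∑ x, √(Nat.count (fun j => o j = x) K : ℝ) := by rw [Finset.mul_sum]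
    _ ≤ 2 * √(Fintype.card O * K) := by
        refine mul_le_mul_of_nonneg_left (Real.le_sqrt_of_sq_le ?_) zero_le_two
        refine sq_sum_le_card_mul_sum_sq.trans_eq ?_
        rw [Finset.card_univ, ← h1]
        congr 1
        exact Finset.sum_congr rfl fun x _ => Real.sq_sqrt (Nat.cast_nonneg _)

omit [Fintype O] in
-- After exchanging the sums, the weights of a fixed visit `j` total at most `1 + 1/H`;
-- nonnegativity of `φ`, supplied later by optimism, allows this bound to be used.
theorem sum_sum_learningWeight_label_le {H : ℕ} (hH : 1 ≤ H) {K : ℕ} {φ : ℕ → ℝ}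
    (hφ : ∀ j < K, 0 ≤ φ j) :
    ∑ k ∈ Finset.range K, ∑ j ∈ Finset.range K, (if o j = o k then
      learningWeight H (Nat.count (fun i => o i = o k) k) (Nat.count (fun i => o i = o k) j) * φ j
        else 0) ≤ (1 + 1 / H) * ∑ j ∈ Finset.range K, φ j := by
  rw [Finset.sum_comm, Finset.mul_sum]
  refine Finset.sum_le_sum fun j hj => ?_
  have h1 : ∀ k, (if o j = o k then learningWeight H (Nat.count (fun i => o i = o k) k)
      (Nat.count (fun i => o i = o k) j) * φ j else 0) =
      (if o k = o j then learningWeight H (Nat.count (fun i => o i = o j) k)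
        (Nat.count (fun i => o i = o j) j) else 0) * φ j := by
    intro k
    by_cases h : o j = o k
    · simp [h]
    · rw [if_neg h, if_neg fun h' => h h'.symm, zero_mul]
  simp only [h1]
  rw [← Finset.sum_mul, sum_ite_count (fun k => o k = o j)
    (fun t => learningWeight H t (Nat.count (fun i => o i = o j) j))]
  exact mul_le_mul_of_nonneg_right (sum_learningWeight_left_le H hH _ _)
    (hφ j (Finset.mem_range.1 hj))

end LabelledSequence

/-! ### Unrolling the recursion over the steps -/

theorem le_sum_pow_mul_of_recursion {ρ : ℝ} (hρ : 0 ≤ ρ) {n : ℕ} (D : Fin (n + 1) → ℝ)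
    (c : Fin n → ℝ) (hD : ∀ h, D h.castSucc ≤ c h + ρ * D h.succ) (hlast : D (Fin.last n) ≤ 0) :
    D 0 ≤ ∑ h : Fin n, ρ ^ (h : ℕ) * c h := by
  induction n with
  | zero => simpa using hlast
  | succ n ih =>
    have := ih (fun h => D h.succ) (fun h => c h.succ) (fun h => hD h.succ) hlast
    rw [Fin.sum_univ_succ]
    have h0 := hD 0
    have h1 : ρ * D (Fin.succ 0) ≤ ρ * ∑ h : Fin n, ρ ^ (h : ℕ) * c h.succ :=
      mul_le_mul_of_nonneg_left this hρ
    rw [Finset.mul_sum] at h1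
    have h2 : ∑ h : Fin n, ρ * (ρ ^ (h : ℕ) * c h.succ) =
        ∑ h : Fin n, ρ ^ (h.succ : ℕ) * c h.succ :=
      Finset.sum_congr rfl fun h _ => by rw [Fin.val_succ, pow_succ']; ring
    simp only [Fin.val_zero, pow_zero, one_mul]
    rw [Fin.castSucc_zero] at h0
    linarith

theorem one_add_one_div_pow_le_three {n : ℕ} (h : Fin n) :
    (1 + 1 / (n : ℝ)) ^ (h : ℕ) ≤ 3 := by
  have hn : (n : ℝ) ≠ 0 := by exact_mod_cast h.pos.ne'
  calc (1 + 1 / (n : ℝ)) ^ (h : ℕ) ≤ (1 + 1 / (n : ℝ)) ^ n :=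
        pow_le_pow_right₀ (le_add_of_nonneg_right (by positivity)) h.isLt.le
    _ ≤ Real.exp (1 / n) ^ n := by
        refine pow_le_pow_left₀ (by positivity) ?_ n
        rw [add_comm]
        exact Real.add_one_le_exp _
    _ = Real.exp 1 := by rw [← Real.exp_nat_mul, mul_one_div_cancel hn]
    _ ≤ 3 := by linarith [Real.exp_one_lt_d9]

/-! ### Optimism and regret on the good event -/

namespace QLearning

section Regret

variable {G S A : Type*} [Group G] [MulAction G S] [MulAction G A] [Fintype S]
  {H : ℕ} {M : EpisodicMDP S A H} {b : ℕ → ℝ} {rule : ActionRule S A H}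
  {ω : ℕ → Trajectory S H}

variable (M b rule ω G) in
open Classical in
/-- The weighted sum of the deviations at the visits of the orbit of `(s, a)` before episode `k`,
with the weights after `t` visits. -/
noncomputable def weightedNoise (h : Fin H) (s : S) (a : A) (t k : ℕ) : ℝ :=
  ∑ j ∈ Finset.range k, if Visits G M b rule ω h s a j then
    learningWeight H t (visitCount G M b rule ω h s a j) * starNoise M b rule ω G h j else 0

variable (M b rule ω G) in
open Classical in
/-- The weighted sum of the overestimations at the visits of the orbit of `(s, a)` before
episode `k`. -/
noncomputable def weightedGap (h : Fin H) (s : S) (a : A) (k : ℕ) : ℝ :=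
  ∑ j ∈ Finset.range k, if Visits G M b rule ω h s a j then
    learningWeight H (visitCount G M b rule ω h s a k) (visitCount G M b rule ω h s a j) *
      nextGap M b rule ω G h.succ j else 0

open Classical in
theorem runTable_Q_sub_eq_add (hM : M.IsSymmetric G) {β : ℝ} (hb : ∀ t, b t = β * (1 / √(t : ℝ)))
    {k : ℕ} {h : Fin H} {s : S} {a : A} (h0 : visitCount G M b rule ω h s a k ≠ 0) :
    (runTable G M b rule ω k).Q h s a - M.starActionValue h s a =
      weightedGap G M b rule ω h s a k +
        weightedNoise G M b rule ω h s a (visitCount G M b rule ω h s a k) k +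
        β * ∑ i ∈ Finset.range (visitCount G M b rule ω h s a k),
          learningWeight H (visitCount G M b rule ω h s a k) i * (1 / √((i + 1 : ℕ) : ℝ)) := by
  rw [runTable_Q_sub_starActionValue b rule ω hM h0, weightedGap, weightedNoise]
  conv_rhs => rw [visitCount, ← sum_ite_count, Finset.mul_sum]
  rw [← Finset.sum_add_distrib, ← Finset.sum_add_distrib]
  refine Finset.sum_congr rfl fun j _ => ?_
  rw [hb]
  split_ifs
  · unfold visitCount; ring
  · ring

/-- The event on which all the weighted deviations are dominated by the bonuses. -/
def NoiseBounded (G : Type*) {S A : Type*} [Group G] [MulAction G S] [MulAction G A] [Fintype S]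
    {H : ℕ} (M : EpisodicMDP S A H) (b : ℕ → ℝ) (rule : ActionRule S A H)
    (ω : ℕ → Trajectory S H) (β : ℝ) (K : ℕ) : Prop :=
  ∀ h s a, ∀ k < K, visitCount G M b rule ω h s a k ≠ 0 →
    |weightedNoise G M b rule ω h s a (visitCount G M b rule ω h s a k) k| ≤
      β * (1 / √(visitCount G M b rule ω h s a k : ℝ))

section Bounds

variable (hM : M.IsSymmetric G) {β : ℝ} (hβ : 0 ≤ β) (hb : ∀ t, b t = β * (1 / √(t : ℝ)))
  {K : ℕ} (hω : NoiseBounded G M b rule ω β K)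

include hM hβ hb hω

theorem runTable_Q_sub_le {k : ℕ} (hk : k < K) {h : Fin H} {s : S} {a : A}
    (h0 : visitCount G M b rule ω h s a k ≠ 0) :
    (runTable G M b rule ω k).Q h s a - M.starActionValue h s a ≤
      weightedGap G M b rule ω h s a k +
        3 * β * (1 / √(visitCount G M b rule ω h s a k : ℝ)) := by
  rw [runTable_Q_sub_eq_add hM hb h0]
  have h1 := (abs_le.1 (hω h s a k hk h0)).2
  have h2 := mul_le_mul_of_nonneg_left
    (sum_learningWeight_div_sqrt_le H (Nat.one_le_iff_ne_zero.2 h0)) hβ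
  -- The constant 3 is 2 from the averaged bonuses and 1 from the noise.
  have h3 : β * (2 / √(visitCount G M b rule ω h s a k : ℝ)) =
    2 * (β * (1 / √(visitCount G M b rule ω h s a k : ℝ))) := by ring
  linarith

/-- The averaged bonus is at least `β/√t`, which cancels the worst noise. -/
theorem le_runTable_Q_sub {k : ℕ} (hk : k < K) {h : Fin H} {s : S} {a : A}
    (h0 : visitCount G M b rule ω h s a k ≠ 0) :
    weightedGap G M b rule ω h s a k ≤
      (runTable G M b rule ω k).Q h s a - M.starActionValue h s a := by
  rw [runTable_Q_sub_eq_add hM hb h0]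
  have h1 := (abs_le.1 (hω h s a k hk h0)).1
  have h2 := mul_le_mul_of_nonneg_left
    (le_sum_learningWeight_div_sqrt H (Nat.one_le_iff_ne_zero.2 h0)) hβ
  linarith

/-- Optimism: the value estimates dominate the optimal values. -/
theorem starValue_le_runTable_V [Finite A] [Nonempty A] (h : Fin (H + 1)) {k : ℕ} (hk : k < K)
    (s : S) : M.starValue h s ≤ (runTable G M b rule ω k).V h s := by
  induction h using Fin.reverseInduction generalizing k s with
  | last => rw [runTable_V_last, starValue_last]
  | cast h ih =>
    rw [runTable_V_castSucc]
    refine le_min (M.starValue_mem_Icc _ _).2 ?_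
    rw [starValue_castSucc]
    refine ciSup_mono (Set.finite_range _).bddAbove fun a => ?_
    by_cases h0 : visitCount G M b rule ω h s a k = 0
    · rw [runTable_Q_of_visitCount_eq_zero M b rule ω h0]
      exact (M.starActionValue_le_starValue h s a).trans (M.starValue_mem_Icc _ _).2
    · refine sub_nonneg.1 (le_trans ?_ (le_runTable_Q_sub hM hβ hb hω hk h0))
      -- The overestimations come from step `h + 1` of earlier episodes, where the induction
      -- hypothesis gives optimism.
      refine Finset.sum_nonneg fun j hj => ?_
      split_ifs
      · exact mul_nonneg (learningWeight_nonneg H _ _)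
          (sub_nonneg.2 (ih ((Finset.mem_range.1 hj).trans hk) _))
      · exact le_rfl

end Bounds

variable (M b rule ω G) in
/-- The difference `V_h^k - V_h^{π^k}` at the state visited at step `h` of episode `k`. -/
noncomputable def policyGap (h : Fin (H + 1)) (k : ℕ) : ℝ :=
  (runTable G M b rule ω k).V h (ω k h) - M.policyValue (runPolicy G M b rule ω k) h (ω k h)

variable (M b rule ω G) in
/-- The deviation of `V_{h+1}^⋆ - V_{h+1}^{π^k}` at the observed next state from its conditional
mean. -/
noncomputable def regretNoise (h : Fin H) (k : ℕ) : ℝ :=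
  M.transition h (fun s => M.starValue h.succ s -
      M.policyValue (runPolicy G M b rule ω k) h.succ s)
    (ω k h.castSucc) (runAction G M b rule ω k h) -
  (M.starValue h.succ (ω k h.succ) -
    M.policyValue (runPolicy G M b rule ω k) h.succ (ω k h.succ))

omit [Fintype S] in
theorem runTable_V_le_Q [Finite A] [Nonempty A] (hrule : rule.IsGreedy) (h : Fin H) (k : ℕ) :
    (runTable G M b rule ω k).V h.castSucc (ω k h.castSucc) ≤
      (runTable G M b rule ω k).Q h (ω k h.castSucc) (runAction G M b rule ω k h) := by
  rw [runTable_V_castSucc]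
  exact (min_le_right _ _).trans (ciSup_le fun a => hrule k _ h _ _ a)

/-- By greediness `V^k - V^π ≤ Q^k - Q^π = (Q^k - Q⋆) + P(V⋆ - V^π)`. Replacing the conditional mean
by the observed next state costs `regretNoise`, and there `V⋆ - V^π` is `policyGap` minus `nextGap`.
-/
theorem policyGap_castSucc_le [Finite A] [Nonempty A] (hrule : rule.IsGreedy) (h : Fin H) (k : ℕ) :
    policyGap G M b rule ω h.castSucc k ≤
      ((runTable G M b rule ω k).Q h (ω k h.castSucc) (runAction G M b rule ω k h) -
        M.starActionValue h (ω k h.castSucc) (runAction G M b rule ω k h)) +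
      regretNoise G M b rule ω h k + policyGap G M b rule ω h.succ k -
      nextGap M b rule ω G h.succ k := by
  have h1 := runTable_V_le_Q (G := G) (M := M) (b := b) (ω := ω) hrule h k
  unfold policyGap regretNoise nextGap starActionValue
  rw [policyValue_castSucc, transition_sub]
  have h2 : runPolicy G M b rule ω k h (ω k h.castSucc) = runAction G M b rule ω k h := rfl
  rw [h2]
  linarith

variable (M b rule ω G) in
/-- The orbit met at step `h` of episode `k`. -/
noncomputable def runOrbit (h : Fin H) (k : ℕ) : MulAction.orbitRel.Quotient G (S × A) :=
  Quotient.mk _ (ω k h.castSucc, runAction G M b rule ω k h)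

omit [Fintype S] in
theorem visits_run_iff (h : Fin H) (j k : ℕ) :
    Visits G M b rule ω h (ω k h.castSucc) (runAction G M b rule ω k h) j ↔
      runOrbit G M b rule ω h j = runOrbit G M b rule ω h k := by
  rw [eq_comm]
  exact (Quotient.eq (r := MulAction.orbitRel G (S × A))).symm

omit [Fintype S] in
open Classical in
theorem visitCount_run (h : Fin H) (j k : ℕ) :
    visitCount G M b rule ω h (ω k h.castSucc) (runAction G M b rule ω k h) j =
      Nat.count (fun i => runOrbit G M b rule ω h i = runOrbit G M b rule ω h k) j := by
  have : Visits G M b rule ω h (ω k h.castSucc) (runAction G M b rule ω k h) =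
      fun i => runOrbit G M b rule ω h i = runOrbit G M b rule ω h k :=
    funext fun i => propext (visits_run_iff h i k)
  unfold visitCount
  simp only [this]

/-- The weighted gaps sum to at most `(1 + 1/H) ∑ φ`, and the term `-φ` leaves only `(1/H) ∑ φ`.
Since `V^π ≤ V⋆`, `φ` is at most `policyGap` at the next step, whence the factor `1 + 1/H`. -/
theorem sum_policyGap_castSucc_le [Finite A] [Nonempty A] (hM : M.IsSymmetric G)
    (hrule : rule.IsGreedy) {β : ℝ} (hβ : 0 ≤ β) (hb : ∀ t, b t = β * (1 / √(t : ℝ)))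
    {K : ℕ} (hω : NoiseBounded G M b rule ω β K) (h : Fin H) :
    ∑ k ∈ Finset.range K, policyGap G M b rule ω h.castSucc k ≤
      (H * orbitCount G S A + 6 * β * √(orbitCount G S A * K) +
        ∑ k ∈ Finset.range K, regretNoise G M b rule ω h k) +
      (1 + 1 / H) * ∑ k ∈ Finset.range K, policyGap G M b rule ω h.succ k := by
  classical
  have hH : 1 ≤ H := h.pos
  have : Fintype A := Fintype.ofFinite A
  have : Fintype (MulAction.orbitRel.Quotient G (S × A)) := Fintype.ofFinite _
  have hO : orbitCount G S A = Fintype.card (MulAction.orbitRel.Quotient G (S × A)) :=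
    Nat.card_eq_fintype_card
  set o := runOrbit G M b rule ω h with ho
  set n : ℕ → ℕ := fun k => Nat.count (fun j => o j = o k) k with hn
  set φ := nextGap M b rule ω G h.succ with hφ
  have hφ0 : ∀ k < K, 0 ≤ φ k := fun k hk =>
    sub_nonneg.2 (starValue_le_runTable_V hM hβ hb hω h.succ hk _)
  have hφδ : ∀ k, φ k ≤ policyGap G M b rule ω h.succ k := fun k =>
    sub_le_sub_left (M.policyValue_le_starValue _ _ _) _
  have key : ∀ k ∈ Finset.range K, policyGap G M b rule ω h.castSucc k ≤
      H * (if n k = 0 then (1 : ℝ) else 0) + 3 * β * (1 / √(n k : ℝ)) +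
      ∑ j ∈ Finset.range K, (if o j = o k then
        learningWeight H (n k) (Nat.count (fun i => o i = o k) j) * φ j else 0) +
      regretNoise G M b rule ω h k + policyGap G M b rule ω h.succ k - φ k := by
    intro k hk
    have hk' := Finset.mem_range.1 hk
    have hnk : visitCount G M b rule ω h (ω k h.castSucc) (runAction G M b rule ω k h) k = n k :=
      visitCount_run h k k
    refine (policyGap_castSucc_le hrule h k).trans ?_
    refine sub_le_sub_right (add_le_add_left (add_le_add_left ?_ _) _) _
    -- On a first visit `Q = H` and `Q⋆ ≥ 0`, so the error is at most `H`; the other terms vanish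
    -- because `1/√0 = 0` and all weights after zero visits are 0.
    by_cases h0 : n k = 0
    · rw [runTable_Q_of_visitCount_eq_zero M b rule ω (hnk.trans h0)]
      simp only [h0, learningWeight, zero_mul, ite_self, Finset.sum_const_zero, if_true]
      have := M.starActionValue_nonneg h (ω k h.castSucc) (runAction G M b rule ω k h)
      simp [this]
    · refine (runTable_Q_sub_le hM hβ hb hω hk' (hnk.trans_ne h0)).trans (le_of_eq ?_)
      rw [if_neg h0, hnk, mul_zero, zero_add, add_comm]
      congr 1
      rw [← hnk, weightedGap]
      refine (sum_learningWeight_count_extend _ H _ hk'.le).trans ?_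
      refine Finset.sum_congr rfl fun j _ => ?_
      rw [← visitCount_run]
      simp only [visits_run_iff, visitCount, ho, hφ]
  have hsum := Finset.sum_le_sum key
  simp only [Finset.sum_add_distrib, Finset.sum_sub_distrib, ← Finset.mul_sum] at hsum
  have h1 := mul_le_mul_of_nonneg_left (sum_count_label_eq_zero_le o K) (Nat.cast_nonneg (α := ℝ) H)
  have h2 := mul_le_mul_of_nonneg_left (sum_one_div_sqrt_count_label_le o K)
    (mul_nonneg zero_le_three hβ)
  have h3 := sum_sum_learningWeight_label_le o hH hφ0
  have h4 : ∑ k ∈ Finset.range K, φ k ≤ ∑ k ∈ Finset.range K, policyGap G M b rule ω h.succ k :=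
    Finset.sum_le_sum fun k _ => hφδ k
  have h5 : (1 / (H : ℝ)) * ∑ k ∈ Finset.range K, φ k ≤
      1 / H * ∑ k ∈ Finset.range K, policyGap G M b rule ω h.succ k :=
    mul_le_mul_of_nonneg_left h4 (by positivity)
  rw [hO]
  linarith

theorem regret_le_of_noiseBounded [Finite A] [Nonempty A] (hM : M.IsSymmetric G)
    (hrule : rule.IsGreedy) {β : ℝ} (hβ : 0 ≤ β) (hb : ∀ t, b t = β * (1 / √(t : ℝ)))
    {K : ℕ} (hω : NoiseBounded G M b rule ω β K) :
    ∑ k ∈ Finset.range K, (M.optimalValue (ω k 0) -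
        M.value (runPolicy G M b rule ω k) (ω k 0)) ≤
      3 * H * (H * orbitCount G S A + 6 * β * √(orbitCount G S A * K)) +
        ∑ k ∈ Finset.range K, ∑ h : Fin H,
          (1 + 1 / (H : ℝ)) ^ (h : ℕ) * regretNoise G M b rule ω h k := by
  set X := (H : ℝ) * orbitCount G S A + 6 * β * √(orbitCount G S A * K) with hX
  have hX0 : 0 ≤ X := by positivity
  calc ∑ k ∈ Finset.range K, (M.optimalValue (ω k 0) -
        M.value (runPolicy G M b rule ω k) (ω k 0))
      ≤ ∑ k ∈ Finset.range K, policyGap G M b rule ω 0 k := by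
        refine Finset.sum_le_sum fun k hk => ?_
        rw [value_eq_policyValue]
        exact sub_le_sub_right ((M.optimalValue_le_starValue _).trans
          (starValue_le_runTable_V hM hβ hb hω 0 (Finset.mem_range.1 hk) _)) _
    _ ≤ ∑ h : Fin H, (1 + 1 / (H : ℝ)) ^ (h : ℕ) *
          (X + ∑ k ∈ Finset.range K, regretNoise G M b rule ω h k) := by
        refine le_sum_pow_mul_of_recursion (by positivity)
          (fun h => ∑ k ∈ Finset.range K, policyGap G M b rule ω h k) _
          (sum_policyGap_castSucc_le hM hrule hβ hb hω) ?_
        simp [policyGap, runTable_V_last]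
    _ = (∑ h : Fin H, (1 + 1 / (H : ℝ)) ^ (h : ℕ) * X) +
          ∑ k ∈ Finset.range K, ∑ h : Fin H,
            (1 + 1 / (H : ℝ)) ^ (h : ℕ) * regretNoise G M b rule ω h k := by
        rw [Finset.sum_comm, ← Finset.sum_add_distrib]
        refine Finset.sum_congr rfl fun h _ => ?_
        rw [mul_add, Finset.mul_sum]
    _ ≤ _ := by
        refine add_le_add_left ?_ _
        refine (Finset.sum_le_sum fun h _ => mul_le_mul_of_nonneg_right
          (one_add_one_div_pow_le_three h) hX0).trans_eq ?_
        simp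
        ring

end Regret

/-! ### Concentration of the noise -/

section Concentration

variable {G S A : Type*} [Group G] [MulAction G S] [MulAction G A] [Fintype S] [Nonempty S]
  {H : ℕ} (M : EpisodicMDP S A H) (b : ℕ → ℝ) (rule : ActionRule S A H)
  (start : InitialStateRule S H)

open Classical in
/-- A run of `K` episodes, continued arbitrarily to an infinite sequence. -/
noncomputable def extendRun {S : Type*} [Nonempty S] {H K : ℕ} (ω : Fin K → Trajectory S H) :
    ℕ → Trajectory S H :=
  fun k => if hk : k < K then ω ⟨k, hk⟩ else fun _ => Classical.arbitrary S

omit [Fintype S] in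
theorem extendRun_coe {K : ℕ} (ω : Fin K → Trajectory S H) (k : Fin K) :
    extendRun ω k = ω k := by
  simp [extendRun]

omit [Fintype S] in
theorem extendRun_past {K : ℕ} (ω : Fin K → Trajectory S H) (k : Fin K) :
    (fun i : Fin k => ω (Fin.castLE k.isLt.le i)) = fun i : Fin k => extendRun ω i :=
  funext fun i => (extendRun_coe ω (Fin.castLE k.isLt.le i)).symm

theorem regret_eq {K : ℕ} (ω : Fin K → Trajectory S H) :
    regret G M b rule ω = ∑ k ∈ Finset.range K, (M.optimalValue (extendRun ω k 0) -
      M.value (runPolicy G M b rule (extendRun ω) k) (extendRun ω k 0)) := by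
  rw [Finset.sum_range]
  refine Finset.sum_congr rfl fun k _ => ?_
  rw [extendRun_past, extendRun_coe]
  rfl

/-- The Azuma–Hoeffding inequality for sums of deviations along a run, with weights `w` and
functions `f` of the next state that may depend on the past episodes. -/
theorem prob_lt_sum_deviation_le (hH : 1 ≤ H) (K : ℕ)
    (w : (k : ℕ) → (Fin k → Trajectory S H) → Fin H → S → ℝ)
    (f : (k : ℕ) → (Fin k → Trajectory S H) → Fin H → S → ℝ)
    (hf : ∀ k past h s, f k past h s ∈ Set.Icc (0 : ℝ) H) {W : ℝ} (hW : 0 < W)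
    (hw : ∀ ω : ℕ → Trajectory S H, ∑ k ∈ Finset.range K, ∑ h : Fin H,
      w k (fun i : Fin k => ω i) h (ω k h.castSucc) ^ 2 ≤ W) {ε : ℝ} (hε : 0 ≤ ε) :
    (runLaw G M b rule start K).prob {ω | ε < ∑ k ∈ Finset.range K, ∑ h : Fin H,
      w k (fun i : Fin k => extendRun ω i) h (extendRun ω k h.castSucc) *
        (f k (fun i : Fin k => extendRun ω i) h (extendRun ω k h.succ) -
          M.transition h (f k (fun i : Fin k => extendRun ω i) h) (extendRun ω k h.castSucc)
            (runAction G M b rule (extendRun ω) k h))} ≤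
      Real.exp (-(ε ^ 2 / (2 * H ^ 2 * W))) := by
  have hH' : (0 : ℝ) < H := by exact_mod_cast hH
  -- `v` is half of `H² W`, matching the compensator `(l w)² H² / 2` of Hoeffding's lemma summed
  -- over all transitions.
  refine (PMF.prob_lt_le_exp (v := H ^ 2 * W / 2) _ (by positivity) (fun l => ?_) hε).trans_eq
    (by congr 3; ring)
  refine le_trans (PMF.expect_mono _ fun ω => ?_) (expect_runLaw_exp_le_one G M b rule start
    (fun k past τ => ∑ h : Fin H, (l * w k past h (τ h.castSucc) * (f k past h (τ h.succ) -
      M.transition h (f k past h) (τ h.castSucc) (policy G M b rule k past h (τ h.castSucc))) -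
      (l * w k past h (τ h.castSucc)) ^ 2 * (H : ℝ) ^ 2 / 2)) (fun k past => ?_) K)
  · refine Real.exp_le_exp.2 ?_
    have h1 := mul_le_mul_of_nonneg_left (hw (extendRun ω))
      (show 0 ≤ l ^ 2 * (H : ℝ) ^ 2 / 2 by positivity)
    have h2 : l ^ 2 * ((H : ℝ) ^ 2 * W / 2) = l ^ 2 * H ^ 2 / 2 * W := by ring
    rw [h2]
    refine (sub_le_sub_left h1 _).trans_eq ?_
    rw [Finset.mul_sum, Finset.mul_sum, ← Finset.sum_sub_distrib, Finset.sum_range]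
    refine Finset.sum_congr rfl fun k _ => ?_
    rw [extendRun_past, Finset.mul_sum, Finset.mul_sum, ← Finset.sum_sub_distrib]
    simp only [extendRun_coe]
    refine Finset.sum_congr rfl fun h _ => ?_
    have h3 : runAction G M b rule (extendRun ω) k h =
        policy G M b rule k (fun i : Fin k => extendRun ω i) h (ω k h.castSucc) := by
      rw [← extendRun_coe ω k]; rfl
    rw [h3]
    ring
  · exact M.expect_trajectoryLaw_exp_le_one _ _ (fun h s s' => l * w k past h s *
      (f k past h s' - M.transition h (f k past h) s (policy G M b rule k past h s)) -
      (l * w k past h s) ^ 2 * (H : ℝ) ^ 2 / 2)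
      fun h s => PMF.expect_exp_le_one _ hH' (hf k past h) _

/-- Here `t` is a fixed number, not the random visit count: the weight of each visit then depends
only on the count before it, so it is predictable, and the squares sum to at most `2H/t` on every
path. The sign `σ` gives both tails. -/
theorem prob_lt_weightedNoise_le [Finite A] [Nonempty A] (hH : 1 ≤ H) (K : ℕ) (h : Fin H)
    (s : S) (a : A) {t : ℕ} (ht : 1 ≤ t) {σ : ℝ} (hσ : σ ^ 2 = 1) {ε : ℝ} (hε : 0 ≤ ε) :
    (runLaw G M b rule start K).prob
      {ω | ε < σ * weightedNoise G M b rule (extendRun ω) h s a t K} ≤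
      Real.exp (-(ε ^ 2 * t / (4 * H ^ 3))) := by
  classical
  have hH' : (0 : ℝ) < H := by exact_mod_cast hH
  have ht' : (0 : ℝ) < t := by exact_mod_cast ht
  have key := prob_lt_sum_deviation_le (G := G) M b rule start hH K
    (fun k past h' x => if h' = h then (if (s, a) ∈ MulAction.orbit G
      (x, policy G M b rule k past h' x) then
        σ * learningWeight H t ((table G M b rule k past).N h' s a) else 0) else 0)
    (fun _ _ h' => M.starValue h'.succ) (fun _ _ h' => M.starValue_mem_Icc h'.succ)
    (W := 2 * H / t) (by positivity) (fun ω => ?_) hε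
  · convert key using 3
    · ext ω
      rw [weightedNoise, Finset.mul_sum]
      refine iff_of_eq (congrArg _ (Finset.sum_congr rfl fun k _ => ?_))
      simp only [ite_mul, zero_mul]
      rw [Finset.sum_ite_eq' Finset.univ h, if_pos (Finset.mem_univ h), mul_ite, mul_zero,
        ← runTable_N, mul_assoc]
      rfl
    · field_simp
      ring
  · have h1 : ∀ k, (∑ h' : Fin H, (if h' = h then (if (s, a) ∈ MulAction.orbit G
        (ω k h'.castSucc, policy G M b rule k (fun i : Fin k => ω i) h' (ω k h'.castSucc)) then
        σ * learningWeight H t ((table G M b rule k (fun i : Fin k => ω i)).N h' s a) else 0)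
          else 0) ^ 2) = if Visits G M b rule ω h s a k then
          learningWeight H t (Nat.count (Visits G M b rule ω h s a) k) ^ 2 else 0 := by
      intro k
      simp only [ite_pow, mul_pow, hσ, one_mul, zero_pow two_ne_zero]
      rw [Finset.sum_ite_eq' Finset.univ h, if_pos (Finset.mem_univ h)]
      have := runTable_N (G := G) M b rule ω k h s a
      unfold visitCount at this
      rw [← this]
      rfl
    simp only [h1]
    rw [sum_ite_count _ (fun i => learningWeight H t i ^ 2)]
    refine le_trans ?_ (sum_learningWeight_sq_le H hH ht)
    set n := Nat.count (Visits G M b rule ω h s a) K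
    refine (Finset.sum_le_sum_of_subset_of_nonneg (Finset.range_mono (le_max_left n t))
      fun i _ _ => sq_nonneg _).trans_eq (Finset.sum_subset (Finset.range_mono (le_max_right n t))
        fun i _ hi => ?_).symm
    rw [learningWeight_eq_zero H (by simpa using hi), zero_pow two_ne_zero]

theorem prob_lt_sum_regretNoise_le [Finite A] [Nonempty A] (hH : 1 ≤ H) {K : ℕ} (hK : 1 ≤ K)
    {ε : ℝ} (hε : 0 ≤ ε) :
    (runLaw G M b rule start K).prob {ω | ε < ∑ k ∈ Finset.range K, ∑ h : Fin H,
      (1 + 1 / (H : ℝ)) ^ (h : ℕ) * regretNoise G M b rule (extendRun ω) h k} ≤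
      Real.exp (-(ε ^ 2 / (18 * H ^ 3 * K))) := by
  have hH' : (0 : ℝ) < H := by exact_mod_cast hH
  have hK' : (0 : ℝ) < K := by exact_mod_cast hK
  have key := prob_lt_sum_deviation_le (G := G) M b rule start hH K
    (fun _ _ h _ => -(1 + 1 / (H : ℝ)) ^ (h : ℕ))
    (fun k past h s => M.starValue h.succ s - M.policyValue (policy G M b rule k past) h.succ s)
    (fun k past h s => ⟨sub_nonneg.2 (M.policyValue_le_starValue _ _ _),
      (sub_le_self _ (M.policyValue_nonneg _ _ _)).trans (M.starValue_mem_Icc _ _).2⟩)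
    -- There are `HK` transitions, each with squared weight at most `3²`.
    (W := 9 * (H * K)) (by positivity) (fun ω => ?_) hε
  · convert key using 3
    · ext ω
      refine iff_of_eq (congrArg _ (Finset.sum_congr rfl fun k _ =>
        Finset.sum_congr rfl fun h _ => ?_))
      unfold regretNoise runPolicy
      ring
    · ring
  · refine (Finset.sum_le_sum fun k _ => Finset.sum_le_sum fun h _ => ?_).trans_eq
      (b := ∑ _k ∈ Finset.range K, ∑ _h : Fin H, (9 : ℝ)) ?_
    · rw [neg_sq]
      have h0 : 0 ≤ (1 + 1 / (H : ℝ)) ^ (h : ℕ) := by positivity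
      nlinarith [one_add_one_div_pow_le_three h]
    · simp
      ring

omit [Nonempty S] in
-- The random count is one of `1, …, K`, so bounds for all fixed counts suffice; this prepares the
-- union bound.
theorem noiseBounded_of_forall_le {β : ℝ} {K : ℕ} {ω : ℕ → Trajectory S H}
    (hω : ∀ h s a (i : Fin K), |weightedNoise G M b rule ω h s a (i + 1) K| ≤
      β * (1 / √((i + 1 : ℕ) : ℝ))) : NoiseBounded G M b rule ω β K := by
  classical
  intro h s a k hk h0
  have h1 : weightedNoise G M b rule ω h s a (visitCount G M b rule ω h s a k) k =
      weightedNoise G M b rule ω h s a (visitCount G M b rule ω h s a k) K :=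
    sum_learningWeight_count_extend _ H _ hk.le
  have h2 : visitCount G M b rule ω h s a k ≤ k := Nat.count_le _
  obtain ⟨n, hn⟩ := Nat.exists_eq_succ_of_ne_zero h0
  rw [h1, hn]
  exact hω h s a ⟨n, by omega⟩

theorem prob_not_noiseBounded_le [Fintype A] [Nonempty A] (hH : 1 ≤ H) (K : ℕ) {ι : ℝ}
    (hι : 0 ≤ ι) :
    (runLaw G M b rule start K).prob
      {ω | NoiseBounded G M b rule (extendRun ω) (4 * √(H ^ 3 * ι)) K}ᶜ ≤
      2 * (Fintype.card S * Fintype.card A * (H * K)) * Real.exp (-(4 * ι)) := by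
  have hH' : (0 : ℝ) < H := by exact_mod_cast hH
  set β := 4 * √((H : ℝ) ^ 3 * ι) with hβ
  have hβ2 : β ^ 2 = 16 * (H ^ 3 * ι) := by
    rw [hβ, mul_pow, Real.sq_sqrt (by positivity)]; norm_num
  let bad : (Fin H × S × A × Fin K) × Bool → Set (Fin K → Trajectory S H) := fun x =>
    {ω | β * (1 / √((x.1.2.2.2 + 1 : ℕ) : ℝ)) < (if x.2 then 1 else -1) *
      weightedNoise G M b rule (extendRun ω) x.1.1 x.1.2.1 x.1.2.2.1 (x.1.2.2.2 + 1) K}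
  have hsub : {ω | NoiseBounded G M b rule (extendRun ω) β K}ᶜ ⊆ ⋃ x, bad x := by
    intro ω hω
    by_contra hbad
    simp only [bad, Set.mem_iUnion, not_exists, Set.mem_ofPred_eq, not_lt] at hbad
    refine (Set.mem_compl_iff _ _).1 hω
      (noiseBounded_of_forall_le M b rule fun h s a i => abs_le.2 ⟨?_, ?_⟩)
    · have := hbad ((h, s, a, i), false)
      simp only [Bool.false_eq_true, if_false] at this
      linarith
    · have := hbad ((h, s, a, i), true)
      simpa only [if_true, one_mul] using this
  refine (PMF.prob_mono _ hsub).trans ((PMF.prob_iUnion_le _ _).trans ?_)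
  -- With `β² = 16 H³ ι` the exponent is `(16 H³ ι / t) · t / (4 H³) = 4ι`.
  have hx : ∀ x, (runLaw G M b rule start K).prob (bad x) ≤ Real.exp (-(4 * ι)) := by
    intro x
    refine (prob_lt_weightedNoise_le M b rule start hH K x.1.1
      x.1.2.1 x.1.2.2.1 (Nat.le_add_left 1 x.1.2.2.2) (σ := if x.2 then 1 else -1)
      (by split_ifs <;> norm_num) (ε := β * (1 / √((x.1.2.2.2 + 1 : ℕ) : ℝ)))
      (by positivity)).trans_eq ?_
    congr 2
    have h1 : (0 : ℝ) < ((x.1.2.2.2 + 1 : ℕ) : ℝ) := by positivity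
    rw [mul_pow, div_pow, Real.sq_sqrt h1.le, hβ2]
    field_simp
    ring
  refine (Finset.sum_le_sum fun x _ => hx x).trans_eq ?_
  simp only [Finset.sum_const, Finset.card_univ, Fintype.card_prod, Fintype.card_fin,
      Fintype.card_bool, nsmul_eq_mul]
  push_cast
  ring

omit [Nonempty S] in
theorem regret_le_mul [Finite A] [Nonempty A] {K : ℕ} (ω : Fin K → Trajectory S H) :
    regret G M b rule ω ≤ H * K := by
  refine (Finset.sum_le_sum (g := fun _ => (H : ℝ)) fun k _ => ?_).trans_eq (by simp [mul_comm])
  rw [value_eq_policyValue]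
  exact (sub_le_self _ (M.policyValue_nonneg _ _ _)).trans
    ((M.optimalValue_le_starValue _).trans (M.starValue_mem_Icc _ _).2)

omit [Nonempty S] in
theorem regret_eq_zero_of_subsingleton [Subsingleton A] {K : ℕ} (ω : Fin K → Trajectory S H) :
    regret G M b rule ω = 0 := by
  refine Finset.sum_eq_zero fun k _ => ?_
  rw [optimalValue, ciSup_subsingleton, sub_self]

end Concentration

/-! ### Numerical inequalities -/

theorem regretBound_le {H K O ι : ℝ} (hH : 1 ≤ H) (hO : 1 ≤ O) (hK : 0 ≤ K) (hOT : O ≤ H * K)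
    (hι : 1 / 2 ≤ ι) :
    3 * H * (H * O + 6 * (4 * √(H ^ 3 * ι)) * √(O * K)) + 6 * √(H ^ 3 * K * ι) ≤
      100 * √(H ^ 4 * O * (H * K) * ι) := by
  set R := √(H ^ 4 * O * (H * K) * ι) with hR
  have h1 : H * H * O ≤ 2 * R := by
    have : H * H * O / 2 ≤ R := by
      refine Real.le_sqrt_of_sq_le ?_
      have h2 : O * (1 / 2) ≤ H * K * ι := mul_le_mul hOT hι (by norm_num) (by positivity)
      have h3 := mul_le_mul_of_nonneg_left h2 (show 0 ≤ H ^ 4 * O by positivity)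
      have h4 : 0 ≤ H ^ 4 * O * O := by positivity
      nlinarith
    linarith
  have h2 : H * (√(H ^ 3 * ι) * √(O * K)) = R := by
    rw [← Real.sqrt_mul (by positivity), hR, ← Real.sqrt_sq (show 0 ≤ H by positivity),
      ← Real.sqrt_mul (by positivity), Real.sqrt_sq (show 0 ≤ H by positivity)]
    congr 1
    ring
  have h3 : √(H ^ 3 * K * ι) ≤ R := by
    refine Real.sqrt_le_sqrt ?_
    have h4 : 1 ≤ H ^ 2 * O := one_le_mul_of_one_le_of_one_le (one_le_pow₀ hH) hO
    have h5 := mul_le_mul_of_nonneg_left h4 (show 0 ≤ H ^ 3 * K * ι by positivity)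
    nlinarith
  -- The three terms are at most `6R`, `72R` and `6R`.
  nlinarith

/-- With at least `HK` orbits the claimed bound already exceeds the trivial regret bound `HK`. -/
theorem le_regretBound {H K O ι : ℝ} (hH : 1 ≤ H) (hK : 0 ≤ K) (hOT : H * K ≤ O)
    (hι : 1 / 2 ≤ ι) : H * K ≤ 100 * √(H ^ 4 * O * (H * K) * ι) := by
  have : H * K / 2 ≤ √(H ^ 4 * O * (H * K) * ι) := by
    refine Real.le_sqrt_of_sq_le ?_
    have h1 : 0 ≤ H * K := by positivity
    have h2 : H * K * (H * K) ≤ O * (H * K) := mul_le_mul_of_nonneg_right hOT h1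
    have h3 : (1 : ℝ) * (1 / 2) ≤ H ^ 4 * ι :=
      mul_le_mul (one_le_pow₀ hH) hι (by norm_num) (by positivity)
    have h4 := mul_le_mul h3 h2 (mul_nonneg h1 h1) (by positivity)
    nlinarith
  have : 0 ≤ √(H ^ 4 * O * (H * K) * ι) := Real.sqrt_nonneg _
  linarith

/-- With `q = p/m = e^{-ι} ≤ 1/2`, the terms are `2 m q⁴ = 2 p q³` and `q² = p q / m`, each at most
`p/4`; a power of `q` absorbs the number of events in the union bound. -/
theorem failureProbability_le {m p ι : ℝ} (hm : 2 ≤ m) (hp : 0 < p) (hp1 : p < 1)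
    (hι : ι = Real.log (m / p)) :
    2 * m * Real.exp (-(4 * ι)) + Real.exp (-(2 * ι)) ≤ p := by
  have hq : Real.exp (-ι) = p / m := by
    rw [hι, ← Real.log_inv, inv_div, Real.exp_log (by positivity)]
  have h4 : Real.exp (-(4 * ι)) = (p / m) ^ 4 := by
    rw [← hq, ← Real.exp_nat_mul]; congr 1; push_cast; ring
  have h2 : Real.exp (-(2 * ι)) = (p / m) ^ 2 := by
    rw [← hq, ← Real.exp_nat_mul]; congr 1; push_cast; ring
  rw [h4, h2]
  have hm0 : 0 < m := by linarith
  set q := p / m with hqdef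
  have hpq : p = q * m := by rw [hqdef]; field_simp
  have hq0 : 0 < q := by positivity
  have hq1 : q ≤ 1 / 2 := by rw [hqdef, div_le_iff₀ hm0]; linarith
  have h5 : q ^ 3 ≤ (1 / 2) ^ 3 := pow_le_pow_left₀ hq0.le hq1 3
  have h6 : 2 * m * q ^ 4 ≤ p / 4 := by
    have := mul_le_mul_of_nonneg_left h5 (show 0 ≤ 2 * (q * m) by positivity)
    rw [hpq]; nlinarith
  have h7 : q ^ 2 ≤ p / 4 := by
    rw [hpq]
    nlinarith
  linarith

end QLearning

/-! ### Degenerate cases and the final union bound -/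

theorem mainTheorem3 :
    ∃ c > (0 : ℝ), ∃ C > (0 : ℝ),
      ∀ (S A G : Type*) [Fintype S] [Nonempty S] [Fintype A] [Nonempty A]
        [Group G] [MulAction G S] [MulAction G A]
        (H K : ℕ) (M : EpisodicMDP S A H) (_ : M.IsSymmetric G)
        (rule : ActionRule S A H) (_ : rule.IsGreedy)
        (start : InitialStateRule S H)
        (p : ℝ) (_ : 0 < p) (_ : p < 1)
        (T : ℕ) (_ : T = H * K)
        (ι : ℝ) (_ : ι = logFactor S A T p)
        (b : ℕ → ℝ) (_ : b = hoeffdingBonus c H ι),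
        ENNReal.ofReal (1 - p) ≤
          (QLearning.runLaw G M b rule start K).toOuterMeasure
            {ω | QLearning.regret G M b rule ω ≤
              C * Real.sqrt ((H : ℝ) ^ 4 * orbitCount G S A * T * ι)} := by
  refine ⟨4, by norm_num, 100, by norm_num, ?_⟩
  intro S A G _ _ _ _ _ _ _ H K M hM rule hrule start p hp hp1 T hT ι hι b hb
  refine PMF.ofReal_one_sub_le_toOuterMeasure _ ?_
  have trivial_of_forall : (∀ ω : Fin K → Trajectory S H, QLearning.regret G M b rule ω ≤
      100 * √((H : ℝ) ^ 4 * orbitCount G S A * T * ι)) →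
      (QLearning.runLaw G M b rule start K).prob {ω | QLearning.regret G M b rule ω ≤
        100 * √((H : ℝ) ^ 4 * orbitCount G S A * T * ι)}ᶜ ≤ p := by
    intro h
    refine (PMF.prob_mono _ (t := ∅) fun ω hω => absurd (h ω) hω).trans ?_
    simp [PMF.prob, PMF.expect, hp.le]
  have hT' : (T : ℝ) = H * K := by rw [hT]; push_cast; rfl
  rcases Nat.eq_zero_or_pos T with hT0 | hT0
  · refine trivial_of_forall fun ω => (QLearning.regret_le_mul M b rule ω).trans ?_
    rw [← hT', hT0]
    simp
  -- With one action there is one policy and no regret. Excluding this case gives `SAT ≥ 2`, hence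
  -- `ι ≥ log 2 > 1/2`.
  rcases subsingleton_or_nontrivial A with hA | hA
  · refine trivial_of_forall fun ω => ?_
    rw [QLearning.regret_eq_zero_of_subsingleton M b rule ω]
    positivity
  have hH : 1 ≤ H := Nat.pos_of_ne_zero fun h => by simp [hT, h] at hT0
  have hK : 1 ≤ K := Nat.pos_of_ne_zero fun h => by simp [hT, h] at hT0
  have hm : (2 : ℝ) ≤ Fintype.card S * Fintype.card A * T := by
    have h1 : 1 ≤ Fintype.card S := Fintype.card_pos
    have h2 : 2 ≤ Fintype.card A := Fintype.one_lt_card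
    have h3 : 2 ≤ Fintype.card S * Fintype.card A * T := by nlinarith [Nat.mul_le_mul h1 h2]
    exact_mod_cast h3
  have hι2 : 1 / 2 ≤ ι := by
    have h1 : (2 : ℝ) ≤ Fintype.card S * Fintype.card A * T / p := by
      rw [le_div_iff₀ hp]; nlinarith
    have h2 := Real.log_le_log two_pos h1
    rw [hι, logFactor]
    linarith [Real.log_two_gt_d9]
  have hH' : (1 : ℝ) ≤ H := by exact_mod_cast hH
  have hO : (1 : ℝ) ≤ orbitCount G S A := by
    have : Nonempty (MulAction.orbitRel.Quotient G (S × A)) :=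
      ⟨Quotient.mk _ (Classical.arbitrary (S × A))⟩
    have : Finite (MulAction.orbitRel.Quotient G (S × A)) := Quotient.finite _
    exact_mod_cast Nat.card_pos (α := MulAction.orbitRel.Quotient G (S × A))
  have hbt : ∀ t, b t = 4 * √((H : ℝ) ^ 3 * ι) * (1 / √(t : ℝ)) := by
    intro t
    rw [hb, hoeffdingBonus, Real.sqrt_div (by positivity)]
    ring
  rcases le_total ((H : ℝ) * K) (orbitCount G S A) with hOT | hOT
  · refine trivial_of_forall fun ω => (QLearning.regret_le_mul M b rule ω).trans ?_
    rw [hT']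
    exact QLearning.le_regretBound hH' (Nat.cast_nonneg K) hOT hι2
  have hsub : {ω : Fin K → Trajectory S H | QLearning.regret G M b rule ω ≤
      100 * √((H : ℝ) ^ 4 * orbitCount G S A * T * ι)}ᶜ ⊆
      {ω | QLearning.NoiseBounded G M b rule (QLearning.extendRun ω)
        (4 * √((H : ℝ) ^ 3 * ι)) K}ᶜ ∪
      -- The constant 6 makes the tail exponent `36/18 · ι = 2ι`.
      {ω | 6 * √((H : ℝ) ^ 3 * K * ι) < ∑ k ∈ Finset.range K, ∑ h : Fin H,
        (1 + 1 / (H : ℝ)) ^ (h : ℕ) *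
          QLearning.regretNoise G M b rule (QLearning.extendRun ω) h k} := by
    intro ω hω
    by_contra hgood
    rw [Set.mem_union, not_or, Set.mem_compl_iff, not_not, Set.mem_ofPred_eq, Set.mem_ofPred_eq,
      not_lt] at hgood
    refine (Set.mem_compl_iff _ _).1 hω ?_
    rw [Set.mem_ofPred_eq, QLearning.regret_eq, hT']
    refine (QLearning.regret_le_of_noiseBounded hM hrule (by positivity) hbt hgood.1).trans
      (le_trans ?_ (QLearning.regretBound_le hH' hO (Nat.cast_nonneg K) hOT hι2))
    exact add_le_add_right hgood.2 _
  refine (PMF.prob_mono _ hsub).trans ((PMF.prob_union_le _ _ _).trans ?_)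
  refine le_trans (add_le_add (QLearning.prob_not_noiseBounded_le M b rule start hH K
    (by linarith)) (QLearning.prob_lt_sum_regretNoise_le M b rule start hH hK (by positivity)))
    (le_trans (le_of_eq ?_) (QLearning.failureProbability_le hm hp hp1 hι))
  have hK' : (0 : ℝ) < K := by exact_mod_cast hK
  rw [hT', mul_pow, Real.sq_sqrt (by positivity)]
  congr 3
  field_simp
  norm_num
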